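/- Let $k>0$ be a fixed real number. The type $B$ $1/k$-derangement polynomials $d_n^B(x;k)\in\mathbb R[x]$ are defined by $$\sum_{n\ge 0}d_n^B(x;k)\frac{z^n}{n!}=\left(\frac{(1-x)e^{kz}}{e^{2kxz}-xe^{2kz}}\right)^{1/k}.$$ Let $B_n$ be the group of signed permutations $w$ of $\{\pm1,\dots,\pm n\}$ (so $w(-i)=-w(i)$), and let $\mathcal D_n^B$ be the set of those $w\in B_n$ with $w(i)\ne i$ for all $i\in[n]=\{1,\dots,n\}$. For $w\in B_n$ let $\mathrm{wexc}(w)$ be the number of $i\in[n]$ such that $w(i)=i$ or $w(|w(i)|)>w(i)$, and let $\mathrm{cyc}(w)$ be the number of cycles (one-element cycles included) of the permutation $i\mapsto|w(i)|$ of $[n]$. Then for all $n\ge1$ $$d_n^B(x;k)=\sum_{\pi\in\mathcal D_n^B}x^{\mathrm{wexc}(\pi)}k^{n-\mathrm{cyc}(\pi)}.$$ Moreover, for all $n\ge 1$, $$d_n^B(x;k)=P_n(x)+Q_n(x),\qquad P_n(x)=\sum_{j=0}^{\lfloor (n-1)/2\rfloor}p(n,j;k)\,x^j(1+x)^{n-1-2j},\qquad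 Q_n(x)=\sum_{j=0}^{\lfloor n/2\rfloor}q(n,j;k)\,x^j(1+x)^{n-2j},$$ where the numbers $p(n,j;k),q(n,j;k)$ ($n\ge 0$, $j\in\mathbb Z$) are determined by $q(0,0;k)=1$, $q(0,j;k)=0$ for $j\ne0$, $p(0,j;k)=0$ for all $j$, and, for $n\ge0$, $$p(n+1,j;k)=(1+2kj)p(n,j;k)+4k(n-2j+1)p(n,j-1;k)+2kn\,p(n-1,j-1;k)+q(n,j;k),$$ $$q(n+1,j;k)=2kj\,q(n,j;k)+4k(n-2j+2)q(n,j-1;k)+2kn\,q(n-1,j-1;k)+(2k-1)p(n,j-1;k)$$ (the terms with the factor $n$ are absent for $n=0$). Here $(P_n(x),Q_n(x)/x)$ is the symmetric decomposition of $d_n^B(x;k)$, that is, the unique pair of polynomials $(a,b)$ with $d_n^B(x;k)=a(x)+xb(x)$, $a(x)=x^da(1/x)$ and $b(x)=x^{d-1}b(1/x)$, where $d$ is the degree of $d_n^B(x;k)$ in $x$. If $k\ge1/2$, then all $p(n,j;k)$ and $q(n,j;k)$ are nonnegative, and for every $n\ge1$ the polynomial $d_n^B(x;k)$ is bi-$\gamma$-positive: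 both polynomials $a,b$ of its symmetric decomposition are $\gamma$-positive, i.e. $a(x)=\sum_{i}\alpha_ix^i(1+x)^{d-2i}$ with $0\le i\le d/2$ and $b(x)=\sum_{i}\beta_ix^i(1+x)^{d-1-2i}$ with $0\le i\le (d-1)/2$, where all $\alpha_i,\beta_i\ge0$. -/

import Mathlib

open Polynomial

noncomputable section

namespace TypeB

/-! ### Signed permutations -/

/-- The hyperoctahedral group `B_n`, as the set of signed permutations: a permutation `|w|` of the
index set (`Fin n`, standing for `[n]` via `i ↦ i + 1`) together with a choice of signs. -/
abbrev SignedPerm (n : ℕ) : Type := Equiv.Perm (Fin n) × (Fin n → ℤˣ)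

namespace SignedPerm

variable {n : ℕ}

/-- `|w(i)|`, as an index. -/
def absIdx (w : SignedPerm n) (i : Fin n) : Fin n := w.1 i

/-- The value `w(i) ∈ {±1, …, ±n}`; the index `i : Fin n` stands for the integer `i + 1`. -/
def val (w : SignedPerm n) (i : Fin n) : ℤ := (w.2 i : ℤ) * (((w.absIdx i : ℕ) : ℤ) + 1)

/-- `i` is a fixed point of `w` if `w(i) = i`. -/
def IsFixed (w : SignedPerm n) (i : Fin n) : Prop := w.val i = ((i : ℕ) : ℤ) + 1

/-- `i` is a weak excedance of `w` if `w(i) = i` or `w(|w(i)|) > w(i)`. -/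
def IsWeakExc (w : SignedPerm n) (i : Fin n) : Prop :=
  w.IsFixed i ∨ w.val i < w.val (w.absIdx i)

open Classical in
/-- The number of weak excedances. -/
def wexc (w : SignedPerm n) : ℕ := (Finset.univ.filter fun i => w.IsWeakExc i).card

/-- The number of cycles of `w`, i.e. of cycles (one-element cycles included) of the permutation
`|w|` of `[n]`: a cycle `(c₁, …, c_m)` of signed letters stands for `w(|c_i|) = c_{i+1}`. -/
def cyc (w : SignedPerm n) : ℕ := w.1.partition.parts.card

end SignedPerm

open Classical in
/-- The derangements of type `B`: signed permutations without fixed points. -/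
def derangements (n : ℕ) : Finset (SignedPerm n) :=
  Finset.univ.filter fun w => ∀ i, ¬ w.IsFixed i

/-! ### The exponential generating function -/

/-- The formal power series `e^{cz}` in `z`. -/
def expSeries {K : Type*} [Field K] (c : K) : PowerSeries K :=
  PowerSeries.mk fun n => c ^ n / (n.factorial : K)

/-- The power `f ^ a = exp (a log f)` of a formal power series `f` with constant term `1`. -/
def seriesPow {K : Type*} [Field K] [CharZero K] (f : PowerSeries K) (a : K) : PowerSeries K :=
  (PowerSeries.exp K).subst (a • PowerSeries.logOf f)

/-- The series `(1 - x) e^{kz} / (e^{2kxz} - x e^{2kz})` in `z` over the field `ℝ(x)`. -/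
def baseSeries (k : ℝ) : PowerSeries (RatFunc ℝ) :=
  PowerSeries.C (1 - RatFunc.X) * expSeries (RatFunc.C k) *
    (expSeries (2 * RatFunc.C k * RatFunc.X) -
      PowerSeries.C RatFunc.X * expSeries (2 * RatFunc.C k))⁻¹

/-- The series `((1 - x) e^{kz} / (e^{2kxz} - x e^{2kz})) ^ (1/k)` in `z` over `ℝ(x)`. -/
def derangementEGF (k : ℝ) : PowerSeries (RatFunc ℝ) :=
  seriesPow (baseSeries k) (RatFunc.C (1 / k))

/-- The type `B` `1/k`-derangement polynomial `d_n^B(x;k)`: `n!` times the coefficient of `z ^ n`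
in `derangementEGF k`, as a polynomial in `x` (the numerator of that rational function; that
nothing is lost thereby is part of the theorem). -/
def derangementPoly (k : ℝ) (n : ℕ) : ℝ[X] :=
  ((n.factorial : RatFunc ℝ) * PowerSeries.coeff n (derangementEGF k)).num

/-! ### Bi-gamma-positivity -/

/-- `∑_{0 ≤ j ≤ m/2} c_j x^j (1 + x)^{m - 2j}`. -/
def gammaSum (m : ℕ) (c : ℕ → ℝ) : ℝ[X] :=
  ∑ j ∈ Finset.range (m / 2 + 1), C (c j) * X ^ j * (1 + X) ^ (m - 2 * j)

/-- `f` is `γ`-positive with respect to `m` (hence symmetric: `f_i = f_{m-i}`). -/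
def IsGammaPositive (m : ℕ) (f : ℝ[X]) : Prop :=
  ∃ c : ℕ → ℝ, (∀ j, 0 ≤ c j) ∧ f = gammaSum m c

/-- `f(x) = x^m f(1/x)`. For `m = -1` this means `f = 0`. -/
def IsSymmetric (m : ℤ) (f : ℝ[X]) : Prop :=
  ∀ x : ℝ, x ≠ 0 → f.eval x = x ^ m * f.eval x⁻¹

/-- `(a, b)` is the symmetric decomposition of `f`: with `d = deg f`, `f = a + x b`,
`a(x) = x^d a(1/x)` and `b(x) = x^{d-1} b(1/x)`. -/
def IsSymmetricDecomposition (f a b : ℝ[X]) : Prop :=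
  f = a + X * b ∧ IsSymmetric f.natDegree a ∧ IsSymmetric ((f.natDegree : ℤ) - 1) b

/-- `f` is bi-`γ`-positive: both members of its symmetric decomposition are `γ`-positive.
(If `deg f = 0`, then `b = 0` by symmetry.) -/
def IsBiGammaPositive (f : ℝ[X]) : Prop :=
  ∃ a b : ℝ[X], IsSymmetricDecomposition f a b ∧
    IsGammaPositive f.natDegree a ∧ IsGammaPositive (f.natDegree - 1) b

end TypeB

end

noncomputable section
namespace TypeB

/-! Everything reduces to one recurrence, `IsDerangementSeq`: d_{n+1} = (1 + 2knx) d_n + 2kx(1-x)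
d_n' + 2knx d_{n-1}, with d_0 = 1. It determines the sequence, and each description of d_n^B is
compared with it.

Generating function. Put H = (e^{2kxz} - x e^{2kz})/(1-x), a series in z with polynomial
coefficients, so that the given series is E = (e^{kz}/H)^{1/k} and H E' = (H - H'/k) E. For a
sequence obeying the recurrence, its generating function G and H both satisfy first-order linear
equations in z and x with the same principal part L = (1 - 2kxz) ∂_z - 2kx(1-x) ∂_x. Hence the
defect H G' - (H - H'/k) G satisfies a homogeneous equation L W = b W and vanishes at z = 0, so it
is zero (`eq_zero_of_transport`, `IsDerangementSeq.linear_ode`). Over ℝ(x), G and E now solve the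
same linear equation in z with the same initial value, so G = E. In particular the coefficients of E
are polynomials.

Signed permutations. View w as a permutation of signed letters and insert the letter ±(n+1) of
largest absolute value, either as a cycle of its own or into one of the n gaps of the cycles. Being
extreme, it creates an ascent unless its gap already was one. This gives a recurrence for the
polynomials F_{n,f} with f positive fixed points (`fixPoly_succ`), in which F_{n,0} is coupled to
F_{n,1}. The identity F_{n,1} = n F_{n-1,0}, a case of `succ_mul_fixPoly_succ`, closes it.

Gamma expansion. Applying the recurrence to each x^j(1+x)^r and re-expanding shows that P_n + Q_n
obeys it exactly when the coefficients p, q evolve as prescribed. For k ≥ 1/2 no negative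
contribution survives in that evolution. The symmetric decomposition follows since d_{n+1} has
degree n and q(n+1,0) = 0. -/

/-! ### Formal power series: linear differential equations and powers -/

theorem derivative_series_mul {R : Type*} [CommRing R] (f g : PowerSeries R) :
    PowerSeries.derivative R (f * g) =
      f * PowerSeries.derivative R g + g * PowerSeries.derivative R f :=
  Derivation.leibniz _ f g

theorem derivative_series_sub {R : Type*} [CommRing R] (f g : PowerSeries R) :
    PowerSeries.derivative R (f - g) =
      PowerSeries.derivative R f - PowerSeries.derivative R g :=
  map_sub _ f g

theorem derivative_series_add {R : Type*} [CommRing R] (f g : PowerSeries R) :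
    PowerSeries.derivative R (f + g) =
      PowerSeries.derivative R f + PowerSeries.derivative R g :=
  map_add _ f g

theorem derivative_series_neg {R : Type*} [CommRing R] (f : PowerSeries R) :
    PowerSeries.derivative R (-f) = -PowerSeries.derivative R f :=
  map_neg _ f

theorem constantCoeff_series_sub {R : Type*} [CommRing R] (f g : PowerSeries R) :
    PowerSeries.constantCoeff (f - g) =
      PowerSeries.constantCoeff f - PowerSeries.constantCoeff g :=
  map_sub _ f g

open PowerSeries in
/-- A power series solution of the linear equation `w' = b w` is determined by its value at `0`. -/
theorem eq_zero_of_derivative_eq_mul {K : Type*} [Field K] [CharZero K] {w b : PowerSeries K}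
    (h : d⁄dX K w = b * w) (h0 : constantCoeff w = 0) : w = 0 := by
  ext n
  induction n using Nat.strong_induction_on with
  | _ n ih =>
    cases n with
    | zero => simpa using h0
    | succ n =>
      have h1 := congrArg (PowerSeries.coeff n) h
      rw [PowerSeries.coeff_derivative, PowerSeries.coeff_mul, Finset.sum_eq_zero] at h1
      · simpa [Nat.cast_add_one_ne_zero] using h1
      · rintro ⟨i, j⟩ hij
        rw [Finset.HasAntidiagonal.mem_antidiagonal] at hij
        rw [ih j (by grind)]
        simp

open PowerSeries in
theorem mul_derivative_logOf {K : Type*} [Field K] [CharZero K] {f : PowerSeries K}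
    (hf : constantCoeff f = 1) : f * d⁄dX K (logOf f) = d⁄dX K f := by
  have hs : HasSubst (f - 1) := HasSubst.of_constantCoeff_zero' (by simp [hf])
  have h1 : (1 + PowerSeries.X) * d⁄dX K (log K) = 1 := by
    rw [deriv_log]
    ext n
    cases n with
    | zero => simp
    | succ n => simp [add_mul, PowerSeries.coeff_succ_X_mul, pow_succ, PowerSeries.coeff_one]
  have h2 := congrArg (PowerSeries.subst (f - 1)) h1
  have e1 : PowerSeries.subst (f - 1) (1 : PowerSeries K) = 1 := by
    rw [← coe_substAlgHom hs, map_one]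
  rw [subst_mul hs, subst_add hs, subst_X hs, e1, add_sub_cancel] at h2
  rw [logOf_eq, derivative_subst hs, ← mul_assoc, h2]
  simp

open PowerSeries in
-- Logarithmic differentiation of f^a = exp(a log f), with the denominator f cleared.
theorem mul_derivative_seriesPow {K : Type*} [Field K] [CharZero K] {f : PowerSeries K}
    (hf : constantCoeff f = 1) (a : K) :
    f * d⁄dX K (seriesPow f a) = a • d⁄dX K f * seriesPow f a := by
  have hs : HasSubst (a • logOf f) :=
    HasSubst.of_constantCoeff_zero' (by simp [constantCoeff_logOf hf])
  rw [seriesPow, derivative_subst hs, derivative_exp, ← mul_derivative_logOf hf, Derivation.map_smul]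
  simp only [PowerSeries.smul_eq_C_mul]
  ring

open PowerSeries in
theorem constantCoeff_seriesPow {K : Type*} [Field K] [CharZero K] {f : PowerSeries K}
    (hf : constantCoeff f = 1) (a : K) : constantCoeff (seriesPow f a) = 1 := by
  have h0 : constantCoeff (a • logOf f) = 0 := by simp [constantCoeff_logOf hf]
  have hs : HasSubst (a • logOf f) := HasSubst.of_constantCoeff_zero' h0
  have h1 : constantCoeff (PowerSeries.subst (a • logOf f) (PowerSeries.exp K - 1)) = 0 :=
    constantCoeff_subst_eq_zero h0 _ (by simp)
  have e1 : PowerSeries.subst (a • logOf f) (1 : PowerSeries K) = 1 := by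
    rw [← coe_substAlgHom hs, map_one]
  have e2 : seriesPow f a = PowerSeries.subst (a • logOf f) (PowerSeries.exp K - 1) + 1 := by
    nth_rw 2 [← e1]
    rw [← subst_add hs, sub_add_cancel, seriesPow]
  rw [e2, map_add, h1]
  simp

theorem derivative_expSeries {K : Type*} [Field K] [CharZero K] (c : K) :
    PowerSeries.derivative K (expSeries c) = PowerSeries.C c * expSeries c := by
  ext n
  rw [PowerSeries.coeff_derivative, PowerSeries.coeff_C_mul, expSeries, PowerSeries.coeff_mk,
    PowerSeries.coeff_mk, Nat.factorial_succ]
  have h1 : ((n : K) + 1) ≠ 0 := Nat.cast_add_one_ne_zero n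
  have h2 : (n.factorial : K) ≠ 0 := by exact_mod_cast n.factorial_ne_zero
  push_cast
  field_simp
  ring

/-! ### Series in z over ℝ[x] and first-order equations in z and x -/

/-- Differentiation of the coefficients of a power series with polynomial coefficients. -/
def coeffDeriv : Derivation ℤ (PowerSeries ℝ[X]) (PowerSeries ℝ[X]) :=
  Derivation.mk'
    (AddMonoidHom.toIntLinearMap
      { toFun := fun f => PowerSeries.mk fun n => derivative (PowerSeries.coeff n f)
        map_zero' := by ext1 n; simp
        map_add' := fun f g => by ext1 n; simp })
    (fun f g => by
      ext1 n
      change PowerSeries.coeff n (PowerSeries.mk fun n => derivative (PowerSeries.coeff n (f * g))) =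
        PowerSeries.coeff n (f * (PowerSeries.mk fun n => derivative (PowerSeries.coeff n g)) +
          g * (PowerSeries.mk fun n => derivative (PowerSeries.coeff n f)))
      simp only [PowerSeries.coeff_mk, PowerSeries.coeff_mul,
        map_add, map_sum, derivative_mul, Finset.sum_add_distrib]
      rw [add_comm]
      congr 1
      rw [← Finset.Nat.sum_antidiagonal_swap]
      exact Finset.sum_congr rfl fun _ _ => mul_comm _ _)

theorem coeff_coeffDeriv (f : PowerSeries ℝ[X]) (n : ℕ) :
    PowerSeries.coeff n (coeffDeriv f) = derivative (PowerSeries.coeff n f) := by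
  change PowerSeries.coeff n (PowerSeries.mk fun n => derivative (PowerSeries.coeff n f)) = _
  rw [PowerSeries.coeff_mk]

theorem coeffDeriv_mul (f g : PowerSeries ℝ[X]) :
    coeffDeriv (f * g) = f * coeffDeriv g + g * coeffDeriv f :=
  Derivation.leibniz _ f g

theorem coeffDeriv_sub (f g : PowerSeries ℝ[X]) :
    coeffDeriv (f - g) = coeffDeriv f - coeffDeriv g :=
  map_sub _ f g

theorem coeffDeriv_C (p : ℝ[X]) :
    coeffDeriv (PowerSeries.C p) = PowerSeries.C (derivative p) := by
  ext1 n
  rw [coeff_coeffDeriv, PowerSeries.coeff_C, PowerSeries.coeff_C]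
  split_ifs <;> simp

theorem derivative_coeffDeriv (f : PowerSeries ℝ[X]) :
    PowerSeries.derivative ℝ[X] (coeffDeriv f) = coeffDeriv (PowerSeries.derivative ℝ[X] f) := by
  ext1 n
  simp only [PowerSeries.coeff_derivative, coeff_coeffDeriv, derivative_mul]
  simp

/-- A solution of `(1 - uz) w_z - v w_x = b w` is determined by its value at `z = 0`. -/
theorem eq_zero_of_transport {u v : ℝ[X]} {w b : PowerSeries ℝ[X]}
    (h : (1 - PowerSeries.C u * PowerSeries.X) * PowerSeries.derivative ℝ[X] w
      - PowerSeries.C v * coeffDeriv w = b * w)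
    (h0 : PowerSeries.constantCoeff w = 0) : w = 0 := by
  ext1 n
  induction n using Nat.strong_induction_on with
  | _ n ih =>
    cases n with
    | zero => simpa using h0
    | succ n =>
      have h1 := congrArg (PowerSeries.coeff n) h
      rw [PowerSeries.coeff_mul n b, Finset.sum_eq_zero] at h1
      swap
      · rintro ⟨i, j⟩ hij
        rw [Finset.HasAntidiagonal.mem_antidiagonal] at hij
        rw [ih j (by grind)]
        simp
      -- Once all coefficients up to z^n vanish, only the term (n+1) w_{n+1} of w_z survives in
      -- degree n.
      · rw [sub_mul, one_mul, map_sub, map_sub, PowerSeries.coeff_derivative, mul_assoc,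
          PowerSeries.coeff_C_mul, PowerSeries.coeff_C_mul, coeff_coeffDeriv, ih n (by omega)] at h1
        have h2 : PowerSeries.coeff n (PowerSeries.X * PowerSeries.derivative ℝ[X] w) = 0 := by
          cases n with
          | zero => simp
          | succ n =>
            rw [PowerSeries.coeff_succ_X_mul, PowerSeries.coeff_derivative, ih (n + 1) (by omega)]
            simp
        rw [h2] at h1
        have h3 : ((n : ℝ[X]) + 1) ≠ 0 := Nat.cast_add_one_ne_zero n
        simpa [h3] using h1

/-- `e^{cz}` for a polynomial `c`. -/
def polyExp (c : ℝ[X]) : PowerSeries ℝ[X] :=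
  PowerSeries.mk fun n => C ((n.factorial : ℝ)⁻¹) * c ^ n

theorem C_factorial_succ (n : ℕ) :
    C (((n + 1).factorial : ℝ)⁻¹) * ((n : ℝ[X]) + 1) = C ((n.factorial : ℝ)⁻¹) := by
  have h : ((n : ℝ[X]) + 1) = C ((n : ℝ) + 1) := by simp
  rw [h, ← C_mul, Nat.factorial_succ]
  congr 1
  have h1 : ((n : ℝ) + 1) ≠ 0 := Nat.cast_add_one_ne_zero n
  have h2 : (n.factorial : ℝ) ≠ 0 := by exact_mod_cast n.factorial_ne_zero
  push_cast
  field_simp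

theorem constantCoeff_polyExp (c : ℝ[X]) : PowerSeries.constantCoeff (polyExp c) = 1 := by
  rw [← PowerSeries.coeff_zero_eq_constantCoeff_apply, polyExp, PowerSeries.coeff_mk]
  simp

theorem derivative_polyExp (c : ℝ[X]) :
    PowerSeries.derivative ℝ[X] (polyExp c) = PowerSeries.C c * polyExp c := by
  ext1 n
  rw [PowerSeries.coeff_derivative, PowerSeries.coeff_C_mul, polyExp, PowerSeries.coeff_mk,
    PowerSeries.coeff_mk, ← C_factorial_succ n]
  ring

theorem coeffDeriv_polyExp (c : ℝ[X]) :
    coeffDeriv (polyExp c) = PowerSeries.C (derivative c) * PowerSeries.X * polyExp c := by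
  ext1 n
  rw [coeff_coeffDeriv, mul_assoc, PowerSeries.coeff_C_mul]
  cases n with
  | zero => simp [polyExp]
  | succ n =>
    rw [PowerSeries.coeff_succ_X_mul, polyExp, PowerSeries.coeff_mk, PowerSeries.coeff_mk,
      derivative_C_mul, derivative_pow, ← C_factorial_succ n]
    simp
    ring

/-- The denominator `(e^{2kxz} - x e^{2kz}) / (1 - x)` has polynomial coefficients. -/
theorem exists_reduced_denominator (k : ℝ) :
    ∃ H : PowerSeries ℝ[X], PowerSeries.C (1 - X) * H =
      polyExp (C (2 * k) * X) - PowerSeries.C X * polyExp (C (2 * k)) := by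
  have h : ∀ n, ∃ q : ℝ[X], (1 - X) * q = PowerSeries.coeff n
      (polyExp (C (2 * k) * X) - PowerSeries.C X * polyExp (C (2 * k))) := by
    intro n
    obtain ⟨q, hq⟩ : (1 - X : ℝ[X]) ∣ PowerSeries.coeff n
        (polyExp (C (2 * k) * X) - PowerSeries.C X * polyExp (C (2 * k))) := by
      -- At x = 1 the two exponentials coincide, so 1 is a root of every coefficient.
      rw [← neg_dvd, neg_sub, ← C_1, dvd_iff_isRoot]
      simp [polyExp, PowerSeries.coeff_C_mul]
    exact ⟨q, hq.symm⟩
  choose q hq using h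
  refine ⟨PowerSeries.mk q, ?_⟩
  ext1 n
  rw [PowerSeries.coeff_C_mul, PowerSeries.coeff_mk, hq]

theorem one_sub_X_ne_zero : (1 - X : ℝ[X]) ≠ 0 := by
  intro h
  simpa using congrArg (eval 0) h

theorem constantCoeff_reduced {k : ℝ} {H : PowerSeries ℝ[X]} (hH : PowerSeries.C (1 - X) * H =
      polyExp (C (2 * k) * X) - PowerSeries.C X * polyExp (C (2 * k))) :
    PowerSeries.constantCoeff H = 1 := by
  have h := congrArg PowerSeries.constantCoeff hH
  refine mul_left_cancel₀ one_sub_X_ne_zero ?_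
  rw [RingHom.map_mul, constantCoeff_series_sub, RingHom.map_mul PowerSeries.constantCoeff,
    PowerSeries.constantCoeff_C, PowerSeries.constantCoeff_C,
    constantCoeff_polyExp, constantCoeff_polyExp, mul_one] at h
  rw [h, mul_one]

theorem coeff_one_reduced {k : ℝ} {H : PowerSeries ℝ[X]} (hH : PowerSeries.C (1 - X) * H =
      polyExp (C (2 * k) * X) - PowerSeries.C X * polyExp (C (2 * k))) :
    PowerSeries.coeff 1 H = 0 := by
  have h := congrArg (PowerSeries.coeff 1) hH
  refine mul_left_cancel₀ one_sub_X_ne_zero ?_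
  rw [PowerSeries.coeff_C_mul, map_sub, PowerSeries.coeff_C_mul] at h
  rw [h, polyExp, polyExp, PowerSeries.coeff_mk, PowerSeries.coeff_mk]
  ring

/-- Multiply by 1 - x: the equation becomes an identity between the z- and x-derivatives of the two
explicit exponentials. The left-hand operator is the one produced by the derangement recurrence. -/
theorem transport_reduced {k : ℝ} {H : PowerSeries ℝ[X]} (hH : PowerSeries.C (1 - X) * H =
      polyExp (C (2 * k) * X) - PowerSeries.C X * polyExp (C (2 * k))) :
    (1 - PowerSeries.C (C (2 * k) * X) * PowerSeries.X) * PowerSeries.derivative ℝ[X] H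
      - PowerSeries.C (C (2 * k) * X * (1 - X)) * coeffDeriv H =
      - PowerSeries.C (C (2 * k) ^ 2 * X) * PowerSeries.X * H := by
  have hne : PowerSeries.C (1 - X : ℝ[X]) ≠ 0 := by
    rw [Ne, ← map_zero (PowerSeries.C (R := ℝ[X])), PowerSeries.C_injective.eq_iff]
    exact one_sub_X_ne_zero
  have hc : derivative (C (2 * k)) = 0 := derivative_C
  generalize C (2 * k) = c at hH hc ⊢
  have h1 := congrArg (PowerSeries.derivative ℝ[X]) hH
  have h2 := congrArg coeffDeriv hH
  refine mul_left_cancel₀ hne ?_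
  rw [derivative_series_mul, PowerSeries.derivative_C, derivative_series_sub,
    derivative_series_mul, PowerSeries.derivative_C, derivative_polyExp, derivative_polyExp] at h1
  rw [coeffDeriv_mul, coeffDeriv_C, coeffDeriv_sub, coeffDeriv_mul,
    coeffDeriv_C, coeffDeriv_polyExp, coeffDeriv_polyExp] at h2
  simp only [derivative_mul, derivative_X, hc, derivative_one, zero_mul, zero_add, mul_one, map_mul, map_one, map_zero, map_sub, map_pow] at h1 h2 hH ⊢
  linear_combination (1 - PowerSeries.C c * PowerSeries.C X * PowerSeries.X) * h1
    - PowerSeries.C c * PowerSeries.C X * (1 - PowerSeries.C X) * h2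
    + (PowerSeries.C c ^ 2 * PowerSeries.C X * PowerSeries.X
      - PowerSeries.C c * PowerSeries.C X) * hH

/-! ### The recurrence and its exponential generating function -/

/-- The recurrence of the type `B` `1/k`-derangement polynomials. -/
structure IsDerangementSeq (k : ℝ) (d : ℕ → ℝ[X]) : Prop where
  zero : d 0 = 1
  succ : ∀ n, d (n + 1) = (1 + C (2 * k) * (n : ℝ[X]) * X) * d n
    + C (2 * k) * X * (1 - X) * derivative (d n) + C (2 * k) * (n : ℝ[X]) * X * d (n - 1)

/-- The exponential generating function of a sequence of polynomials. -/
def polyEGF (d : ℕ → ℝ[X]) : PowerSeries ℝ[X] :=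
  PowerSeries.mk fun n => C ((n.factorial : ℝ)⁻¹) * d n

theorem coeff_derivative_polyEGF (d : ℕ → ℝ[X]) (n : ℕ) :
    PowerSeries.coeff n (PowerSeries.derivative ℝ[X] (polyEGF d)) =
      C ((n.factorial : ℝ)⁻¹) * d (n + 1) := by
  rw [PowerSeries.coeff_derivative, polyEGF, PowerSeries.coeff_mk, ← C_factorial_succ n]
  ring

/-- This is the recurrence read off at z^n/n!, where n d_n comes from z G_z and n d_{n-1} from z G.
-/
theorem IsDerangementSeq.transport {k : ℝ} {d : ℕ → ℝ[X]} (h : IsDerangementSeq k d) :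
    (1 - PowerSeries.C (C (2 * k) * X) * PowerSeries.X) *
        PowerSeries.derivative ℝ[X] (polyEGF d)
      - PowerSeries.C (C (2 * k) * X * (1 - X)) * coeffDeriv (polyEGF d) =
      (1 + PowerSeries.C (C (2 * k) * X) * PowerSeries.X) * polyEGF d := by
  ext1 n
  rw [sub_mul, add_mul, one_mul, one_mul, map_sub, map_sub, map_add,
    mul_assoc (PowerSeries.C _) PowerSeries.X (PowerSeries.derivative ℝ[X] _),
    mul_assoc (PowerSeries.C _) PowerSeries.X (polyEGF d),
    PowerSeries.coeff_C_mul, PowerSeries.coeff_C_mul, PowerSeries.coeff_C_mul, coeff_coeffDeriv,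
    coeff_derivative_polyEGF, h.succ n]
  have e1 : PowerSeries.coeff n (polyEGF d) = C ((n.factorial : ℝ)⁻¹) * d n := by
    rw [polyEGF, PowerSeries.coeff_mk]
  have e2 : PowerSeries.coeff n (PowerSeries.X * PowerSeries.derivative ℝ[X] (polyEGF d)) =
      C ((n.factorial : ℝ)⁻¹) * (n * d n) := by
    cases n with
    | zero => simp
    | succ n =>
      rw [PowerSeries.coeff_succ_X_mul, coeff_derivative_polyEGF, ← C_factorial_succ n]
      push_cast
      ring
  have e3 : PowerSeries.coeff n (PowerSeries.X * polyEGF d) =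
      C ((n.factorial : ℝ)⁻¹) * (n * d (n - 1)) := by
    cases n with
    | zero => simp
    | succ n =>
      rw [PowerSeries.coeff_succ_X_mul, polyEGF, PowerSeries.coeff_mk, ← C_factorial_succ n]
      push_cast
      ring
  rw [e1, e2, e3, derivative_C_mul]
  ring

/-- The logarithmic derivative of (e^{kz}/H)^{1/k} is 1 - H'/(kH). The same holds for the generating
function G, with denominators cleared, because the difference of the two sides is annihilated by
uniqueness for a transport equation. -/
theorem IsDerangementSeq.linear_ode {k : ℝ} (hk : k ≠ 0) {d : ℕ → ℝ[X]} (h : IsDerangementSeq k d)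
    {H : PowerSeries ℝ[X]} (hH : PowerSeries.C (1 - X) * H =
      polyExp (C (2 * k) * X) - PowerSeries.C X * polyExp (C (2 * k))) :
    PowerSeries.derivative ℝ[X] (polyEGF d) * H =
      (H - PowerSeries.C (C (1 / k)) * PowerSeries.derivative ℝ[X] H) * polyEGF d := by
  have hG := h.transport
  have hT := transport_reduced hH
  have hG' := congrArg (PowerSeries.derivative ℝ[X]) hG
  have hT' := congrArg (PowerSeries.derivative ℝ[X]) hT
  have hce : PowerSeries.C (C (2 * k)) * PowerSeries.C (C (1 / k)) = (2 : PowerSeries ℝ[X]) := by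
    rw [← map_mul, ← map_mul, mul_assoc, mul_one_div_cancel hk, mul_one]
    exact (congrArg PowerSeries.C (map_ofNat C 2)).trans (map_ofNat PowerSeries.C 2)
  have hde : derivative (C (1 / k)) = 0 := derivative_C
  have hd1 : PowerSeries.constantCoeff (PowerSeries.derivative ℝ[X] (polyEGF d)) = 1 := by
    rw [← PowerSeries.coeff_zero_eq_constantCoeff_apply, coeff_derivative_polyEGF, h.succ 0, h.zero]
    simp
  have hd0 : PowerSeries.constantCoeff (polyEGF d) = 1 := by
    rw [← PowerSeries.coeff_zero_eq_constantCoeff_apply, polyEGF, PowerSeries.coeff_mk, h.zero]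
    simp
  have hH0 := constantCoeff_reduced hH
  have hH1 : PowerSeries.constantCoeff (PowerSeries.derivative ℝ[X] H) = 0 := by
    rw [← PowerSeries.coeff_zero_eq_constantCoeff_apply, PowerSeries.coeff_derivative,
      coeff_one_reduced hH, zero_mul]
  have hde : derivative (C (1 / k)) = 0 := derivative_C
  have hdc : derivative (C (2 * k)) = 0 := derivative_C
  rw [← sub_eq_zero]
  generalize C (2 * k) = c at *
  generalize C (1 / k) = e at *
  -- Let c = 2k, e = 1/k, and let L be the transport operator. Then L G_z = (1 + cxz + cx) G_z + cxG
  -- and L H = -c²xz H, and b is the sum of these two factors. The leftover terms cxGH cancel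
  -- because ce = 2.
  refine eq_zero_of_transport (u := c * X) (v := c * X * (1 - X))
    (b := 1 + PowerSeries.C (c * X) * PowerSeries.X
      - PowerSeries.C c * PowerSeries.C (c * X) * PowerSeries.X + PowerSeries.C (c * X)) ?_ ?_
  · simp only [derivative_series_mul, derivative_series_sub, derivative_series_add,
      PowerSeries.derivative_C, PowerSeries.derivative_X, PowerSeries.derivative_one,
      derivative_coeffDeriv, coeffDeriv_mul, coeffDeriv_sub, coeffDeriv_C, hde,
      derivative_series_neg] at hG' hT' ⊢
    simp only [map_mul, map_pow, map_sub, map_zero, map_one] at *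
    generalize PowerSeries.C c = c at *
    generalize PowerSeries.C e = e at *
    generalize PowerSeries.C (X : ℝ[X]) = x at *
    linear_combination H * hG' + PowerSeries.derivative ℝ[X] (polyEGF d) * hT
      - polyEGF d * (hT - e * hT') - (H - e * PowerSeries.derivative ℝ[X] H) * hG
      - c * x * H * polyEGF d * hce
  · rw [constantCoeff_series_sub, RingHom.map_mul, RingHom.map_mul,
      constantCoeff_series_sub, RingHom.map_mul, hd1, hd0, hH0, hH1]
    simp

theorem map_derivative_series {R S : Type*} [CommRing R] [CommRing S] (φ : R →+* S)
    (f : PowerSeries R) : PowerSeries.map φ (PowerSeries.derivative R f) =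
      PowerSeries.derivative S (PowerSeries.map φ f) := by
  ext1 n
  simp [PowerSeries.coeff_derivative]

theorem constantCoeff_map_series {R S : Type*} [CommRing R] [CommRing S] (φ : R →+* S)
    (f : PowerSeries R) : PowerSeries.constantCoeff (PowerSeries.map φ f) =
      φ (PowerSeries.constantCoeff f) := by
  rw [← PowerSeries.coeff_zero_eq_constantCoeff_apply, PowerSeries.coeff_map,
    PowerSeries.coeff_zero_eq_constantCoeff_apply]

theorem map_polyExp (c : ℝ[X]) :
    PowerSeries.map (algebraMap ℝ[X] (RatFunc ℝ)) (polyExp c) =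
      expSeries (algebraMap ℝ[X] (RatFunc ℝ) c) := by
  ext1 n
  rw [PowerSeries.coeff_map, polyExp, expSeries, PowerSeries.coeff_mk, PowerSeries.coeff_mk,
    map_mul, map_pow, RatFunc.algebraMap_C, map_inv₀, map_natCast]
  field_simp

/-- A sequence satisfying the recurrence has `derangementEGF` as exponential generating function. -/
theorem IsDerangementSeq.egf {k : ℝ} (hk : k ≠ 0) {d : ℕ → ℝ[X]} (h : IsDerangementSeq k d) :
    derangementEGF k = PowerSeries.map (algebraMap ℝ[X] (RatFunc ℝ)) (polyEGF d) := by
  obtain ⟨H, hH⟩ := exists_reduced_denominator k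
  have hode := congrArg (PowerSeries.map (algebraMap ℝ[X] (RatFunc ℝ))) (h.linear_ode hk hH)
  have hD := congrArg (PowerSeries.map (algebraMap ℝ[X] (RatFunc ℝ))) hH
  have hH0 := congrArg (algebraMap ℝ[X] (RatFunc ℝ)) (constantCoeff_reduced hH)
  have hd0 : algebraMap ℝ[X] (RatFunc ℝ) (PowerSeries.constantCoeff (polyEGF d)) = 1 := by
    rw [← PowerSeries.coeff_zero_eq_constantCoeff_apply, polyEGF, PowerSeries.coeff_mk, h.zero]
    simp
  rw [map_one, ← constantCoeff_map_series] at hH0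
  rw [← constantCoeff_map_series] at hd0
  have hx : (1 - RatFunc.X : RatFunc ℝ) ≠ 0 := by
    rw [← RatFunc.algebraMap_X, ← map_one (algebraMap ℝ[X] (RatFunc ℝ)), ← map_sub]
    exact RatFunc.algebraMap_ne_zero one_sub_X_ne_zero
  have hmapsub : ∀ f g : PowerSeries ℝ[X], PowerSeries.map (algebraMap ℝ[X] (RatFunc ℝ)) (f - g) =
    PowerSeries.map (algebraMap ℝ[X] (RatFunc ℝ)) f -
      PowerSeries.map (algebraMap ℝ[X] (RatFunc ℝ)) g := fun f g => map_sub _ f g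
  rw [map_mul, map_mul, hmapsub, map_mul, PowerSeries.map_C, map_derivative_series,
    map_derivative_series, RatFunc.algebraMap_C] at hode
  rw [map_mul, hmapsub, map_mul (PowerSeries.map _), PowerSeries.map_C, PowerSeries.map_C,
    map_polyExp, map_polyExp, map_sub, map_one, map_mul, RatFunc.algebraMap_X, RatFunc.algebraMap_C] at hD
  generalize PowerSeries.map (algebraMap ℝ[X] (RatFunc ℝ)) H = U at *
  generalize PowerSeries.map (algebraMap ℝ[X] (RatFunc ℝ)) (polyEGF d) = G at *
  have hC2 : RatFunc.C (2 * k) = 2 * RatFunc.C k := by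
    rw [map_mul, map_ofNat]
  rw [hC2] at hD
  have hFU : baseSeries k * U = expSeries (RatFunc.C k) := by
    have hne : PowerSeries.constantCoeff (PowerSeries.C (1 - RatFunc.X) * U) ≠ 0 := by
      rw [map_mul, hH0, PowerSeries.constantCoeff_C, mul_one]
      exact hx
    rw [baseSeries, ← hD]
    have := PowerSeries.mul_inv_cancel _ hne
    linear_combination expSeries (RatFunc.C k) * this
  have hexp0 : PowerSeries.constantCoeff (expSeries (RatFunc.C k)) = 1 := by
    rw [← PowerSeries.coeff_zero_eq_constantCoeff_apply, expSeries, PowerSeries.coeff_mk]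
    simp
  have hF0 : PowerSeries.constantCoeff (baseSeries k) = 1 := by
    have := congrArg PowerSeries.constantCoeff hFU
    rwa [map_mul, hH0, hexp0, mul_one] at this
  have hE := mul_derivative_seriesPow hF0 (RatFunc.C (1 / k))
  have hE0 := constantCoeff_seriesPow hF0 (RatFunc.C (1 / k))
  rw [← derangementEGF] at hE hE0
  rw [PowerSeries.smul_eq_C_mul] at hE
  have hFU' := congrArg (PowerSeries.derivative (RatFunc ℝ)) hFU
  rw [derivative_series_mul, derivative_expSeries, ← hFU] at hFU'
  have hce : PowerSeries.C (RatFunc.C k) * PowerSeries.C (RatFunc.C (1 / k)) =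
      (1 : PowerSeries (RatFunc ℝ)) := by
    rw [← map_mul, ← map_mul, mul_one_div_cancel hk]
    simp
  have hFne : baseSeries k ≠ 0 := by
    intro h0
    rw [h0] at hF0
    simp at hF0
  have hUne : U ≠ 0 := by
    intro h0
    rw [h0] at hH0
    simp at hH0
  have hEU : PowerSeries.derivative (RatFunc ℝ) (derangementEGF k) * U =
      (U - PowerSeries.C (RatFunc.C (1 / k)) * PowerSeries.derivative (RatFunc ℝ) U) *
        derangementEGF k := by
    -- With F the base series, the equation F E' = (1/k) F' E is combined with the derivative of F U
    -- = e^{kz}, and F is cancelled.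
    refine mul_left_cancel₀ hFne ?_
    linear_combination U * hE + PowerSeries.C (RatFunc.C (1 / k)) * derangementEGF k * hFU'
      + baseSeries k * U * derangementEGF k * hce
  rw [← sub_eq_zero]
  have hUinv : U * U⁻¹ = 1 := PowerSeries.mul_inv_cancel _ (by rw [hH0]; exact one_ne_zero)
  refine eq_zero_of_derivative_eq_mul (b := U⁻¹ * (U - PowerSeries.C (RatFunc.C (1 / k)) *
    PowerSeries.derivative (RatFunc ℝ) U)) ?_ ?_
  · rw [derivative_series_sub]
    linear_combination U⁻¹ * (hEU - hode) - (PowerSeries.derivative (RatFunc ℝ) (derangementEGF k)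
      - PowerSeries.derivative (RatFunc ℝ) G) * hUinv
  · rw [constantCoeff_series_sub, hE0, hd0, sub_self]

theorem IsDerangementSeq.derangementPoly_eq {k : ℝ} (hk : k ≠ 0) {d : ℕ → ℝ[X]}
    (h : IsDerangementSeq k d) (n : ℕ) : derangementPoly k n = d n := by
  rw [derangementPoly, h.egf hk, PowerSeries.coeff_map, polyEGF, PowerSeries.coeff_mk, map_mul,
    RatFunc.algebraMap_C, map_inv₀, map_natCast, mul_inv_cancel_left₀, RatFunc.num_algebraMap]
  exact_mod_cast n.factorial_ne_zero

theorem IsDerangementSeq.mk_derangementPoly {k : ℝ} (hk : k ≠ 0) {d : ℕ → ℝ[X]}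
    (h : IsDerangementSeq k d) :
    PowerSeries.mk (fun n : ℕ =>
      algebraMap ℝ[X] (RatFunc ℝ) (derangementPoly k n) / (n.factorial : RatFunc ℝ)) =
      derangementEGF k := by
  ext1 n
  rw [PowerSeries.coeff_mk, h.derangementPoly_eq hk, h.egf hk, PowerSeries.coeff_map, polyEGF,
    PowerSeries.coeff_mk, map_mul, RatFunc.algebraMap_C, map_inv₀, map_natCast, div_eq_inv_mul]

/-! ### The number of letters minus the number of cycles -/

section ReflectionLength

open Equiv.Perm

variable {α : Type*} [Fintype α] [DecidableEq α]

/-- The number of points minus the number of cycles of a permutation. -/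
def reflLength (σ : Equiv.Perm α) : ℕ := σ.support.card - σ.cycleType.card

theorem card_cycleType_le (σ : Equiv.Perm α) : σ.cycleType.card ≤ σ.support.card := by
  rw [← sum_cycleType]
  have := Multiset.card_nsmul_le_sum (s := σ.cycleType) (a := 1)
    fun x hx => (one_lt_of_mem_cycleType hx).le
  simpa using this

theorem card_sub_card_parts (σ : Equiv.Perm α) :
    Fintype.card α - σ.partition.parts.card = reflLength σ := by
  have h1 := card_cycleType_le σ
  have h2 := Finset.card_le_univ σ.support
  rw [parts_partition, Multiset.card_add, Multiset.card_replicate, reflLength]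
  omega

theorem reflLength_mul {σ τ : Equiv.Perm α} (h : Disjoint σ τ) :
    reflLength (σ * τ) = reflLength σ + reflLength τ := by
  have h1 := card_cycleType_le σ
  have h2 := card_cycleType_le τ
  rw [reflLength, reflLength, reflLength, h.cycleType_mul, h.card_support_mul, Multiset.card_add]
  omega

theorem reflLength_of_isCycle {σ : Equiv.Perm α} (h : IsCycle σ) :
    reflLength σ = σ.support.card - 1 := by
  rw [reflLength, h.cycleType, Multiset.card_singleton]

theorem reflLength_swap_mul_of_isCycle {g : Equiv.Perm α} (hg : IsCycle g) {x : α} (hx : g x ≠ x) :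
    reflLength g = reflLength (Equiv.swap x (g x) * g) + 1 := by
  by_cases h : g (g x) = x
  · have h1 := hg.eq_swap_of_apply_apply_eq_self hx h
    have h2 : Equiv.swap x (g x) * g = 1 := by
      nth_rw 2 [h1]
      exact Equiv.swap_mul_self _ _
    rw [h2, reflLength_of_isCycle hg, h1, card_support_swap hx.symm]
    simp [reflLength]
  · rw [reflLength_of_isCycle hg, reflLength_of_isCycle (hg.swap_mul hx h), support_swap_mul_eq _ _ h,
      Finset.card_sdiff_of_subset (by simpa using hx), Finset.card_singleton]
    have := hg.two_le_card_support
    omega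

/-- The transposition turns x into a fixed point and closes up the rest of its cycle, which loses
one letter (a 2-cycle disappears). The cycle through x is split off, and the disjoint remainder is
unaffected. -/
theorem reflLength_swap_mul (σ : Equiv.Perm α) {x : α} (hx : σ x ≠ x) :
    reflLength σ = reflLength (Equiv.swap x (σ x) * σ) + 1 := by
  have hg : IsCycle (σ.cycleOf x) := (isCycle_cycleOf_iff σ).2 hx
  have hd : Disjoint (σ.cycleOf x) (σ * (σ.cycleOf x)⁻¹) :=
    (disjoint_mul_inv_of_mem_cycleFactorsFinset
      (cycleOf_mem_cycleFactorsFinset_iff.2 (mem_support.2 hx))).symm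
  have hprod : σ.cycleOf x * (σ * (σ.cycleOf x)⁻¹) = σ := by
    rw [hd.commute.eq, inv_mul_cancel_right]
  have hgx : σ.cycleOf x x = σ x := cycleOf_apply_self σ x
  have hd' : Disjoint (Equiv.swap x (σ.cycleOf x x) * σ.cycleOf x) (σ * (σ.cycleOf x)⁻¹) := by
    rw [disjoint_iff_disjoint_support] at hd ⊢
    exact Finset.disjoint_of_subset_left
      (fun y hy => (mem_support_swap_mul_imp_mem_support_ne hy).1) hd
  have hcyc := reflLength_swap_mul_of_isCycle hg (x := x) (by rwa [hgx])
  have h1 : reflLength σ = _ := (congrArg reflLength hprod.symm).trans (reflLength_mul hd)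
  have h2 := reflLength_mul hd'
  rw [mul_assoc, hprod, hgx] at h2
  rw [hgx] at hcyc
  omega

theorem reflLength_conj (σ τ : Equiv.Perm α) : reflLength (τ * σ * τ⁻¹) = reflLength σ := by
  rw [reflLength, reflLength, cycleType_conj, card_support_conj]

end ReflectionLength

theorem decomposeFin_symm_zero_eq_extendDomain {n : ℕ} (τ : Equiv.Perm (Fin n)) :
    Equiv.Perm.decomposeFin.symm (0, τ) = τ.extendDomain (finSuccAboveEquiv (0 : Fin (n + 1))) := by
  ext x
  congr 1
  refine Fin.cases ?_ (fun a => ?_) x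
  · rw [Equiv.Perm.decomposeFin_symm_apply_zero, Equiv.Perm.extendDomain_apply_not_subtype]
    simp
  · have h := Equiv.Perm.extendDomain_apply_image τ (finSuccAboveEquiv (0 : Fin (n + 1))) a
    simp only [finSuccAboveEquiv_apply, Fin.succAbove_zero] at h
    rw [h, Equiv.Perm.decomposeFin_symm_apply_succ]
    simp

theorem reflLength_decomposeFin_symm_zero {n : ℕ} (τ : Equiv.Perm (Fin n)) :
    reflLength (Equiv.Perm.decomposeFin.symm (0, τ)) = reflLength τ := by
  rw [decomposeFin_symm_zero_eq_extendDomain, reflLength, reflLength,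
    Equiv.Perm.cycleType_extendDomain, Equiv.Perm.card_support_extend_domain]

/-- Here 0 sits inside a cycle of τ, immediately before the letter `i.succ`. Detaching it leaves τ
with 0 fixed. -/
theorem reflLength_decomposeFin_symm_succ {n : ℕ} (i : Fin n) (τ : Equiv.Perm (Fin n)) :
    reflLength (Equiv.Perm.decomposeFin.symm (i.succ, τ)) = reflLength τ + 1 := by
  have h0 : Equiv.Perm.decomposeFin.symm (i.succ, τ) 0 = i.succ :=
    Equiv.Perm.decomposeFin_symm_apply_zero _ _
  have h1 : Equiv.swap 0 i.succ * Equiv.Perm.decomposeFin.symm (i.succ, τ) =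
      Equiv.Perm.decomposeFin.symm (0, τ) := by
    ext x
    congr 1
    refine Fin.cases ?_ (fun a => ?_) x
    · simp
    · simp [Equiv.Perm.decomposeFin_symm_apply_succ]
  rw [reflLength_swap_mul _ (x := 0) (by rw [h0]; exact Fin.succ_ne_zero i), h0, h1,
    reflLength_decomposeFin_symm_zero]

/-! ### Insertion of an extreme letter -/

/-- The number of ascents `c_j < c_{σ j}` along the cycles of `σ`, where the letter `j` has the
value `c_j`. -/
def asc {n : ℕ} (c : Fin n → ℤ) (σ : Equiv.Perm (Fin n)) : ℕ :=
  (Finset.univ.filter fun j => c j < c (σ j)).card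

/-- The number of fixed points of `σ` whose letter is positive. -/
def posFix {n : ℕ} (c : Fin n → ℤ) (σ : Equiv.Perm (Fin n)) : ℕ :=
  (Finset.univ.filter fun j => σ j = j ∧ 0 < c j).card

section Insertion

variable {n : ℕ} (c : Fin (n + 1) → ℤ) (τ : Equiv.Perm (Fin n))

theorem asc_insert_zero :
    asc c (Equiv.Perm.decomposeFin.symm (0, τ)) = asc (fun j => c j.succ) τ := by
  rw [asc, asc, Finset.card_filter, Finset.card_filter, Fin.sum_univ_succ]
  simp [Equiv.Perm.decomposeFin_symm_apply_succ]

theorem posFix_insert_zero :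
    posFix c (Equiv.Perm.decomposeFin.symm (0, τ)) =
      posFix (fun j => c j.succ) τ + if 0 < c 0 then 1 else 0 := by
  rw [posFix, posFix, Finset.card_filter, Finset.card_filter, Fin.sum_univ_succ, add_comm]
  simp [Equiv.Perm.decomposeFin_symm_apply_succ]

/-- The step from a to τ a is replaced by the two steps a → 0 → τ a. As the letter 0 is extreme,
exactly one of them is an ascent. -/
theorem asc_insert (hc : (∀ j : Fin n, c 0 < c j.succ) ∨ ∀ j : Fin n, c j.succ < c 0) (a : Fin n) :
    asc c (Equiv.Perm.decomposeFin.symm ((τ a).succ, τ)) +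
      (if c a.succ < c (τ a).succ then 1 else 0) = asc (fun j => c j.succ) τ + 1 := by
  rw [asc, asc, Finset.card_filter, Finset.card_filter, Fin.sum_univ_succ,
    ← Finset.add_sum_erase _ _ (Finset.mem_univ a),
    ← Finset.add_sum_erase _ (fun j => if c j.succ < c (τ j).succ then 1 else 0)
      (Finset.mem_univ a)]
  have h : ∀ x ∈ Finset.univ.erase a,
      (if c x.succ < c (Equiv.Perm.decomposeFin.symm ((τ a).succ, τ) x.succ) then 1 else 0) =
        if c x.succ < c (τ x).succ then 1 else 0 := by
    intro x hx
    have hne : τ x ≠ τ a := fun e => Finset.ne_of_mem_erase hx (τ.injective e)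
    rw [Equiv.Perm.decomposeFin_symm_apply_succ, Equiv.swap_apply_of_ne_of_ne (Fin.succ_ne_zero _)
      (fun e => hne (Fin.succ_injective _ e))]
  rw [Finset.sum_congr rfl h, Equiv.Perm.decomposeFin_symm_apply_succ,
    Equiv.Perm.decomposeFin_symm_apply_zero, Equiv.swap_apply_right]
  have h1 : (if c 0 < c (τ a).succ then 1 else 0) + (if c a.succ < c 0 then 1 else 0) = 1 := by
    rcases hc with hc | hc
    · rw [if_pos (hc _), if_neg (hc _).not_gt]
    · rw [if_neg (hc _).not_gt, if_pos (hc _)]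
  omega

/-- Only the point a can cease to be fixed, and the new letter lies in a cycle of length at least 2.
-/
theorem posFix_insert (a : Fin n) :
    posFix c (Equiv.Perm.decomposeFin.symm ((τ a).succ, τ)) +
      (if τ a = a ∧ 0 < c a.succ then 1 else 0) = posFix (fun j => c j.succ) τ := by
  rw [posFix, posFix, Finset.card_filter, Finset.card_filter, Fin.sum_univ_succ,
    ← Finset.add_sum_erase _ _ (Finset.mem_univ a),
    ← Finset.add_sum_erase _ (fun j => if τ j = j ∧ 0 < c j.succ then 1 else 0)
      (Finset.mem_univ a)]
  have h : ∀ x ∈ Finset.univ.erase a,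
      (if Equiv.Perm.decomposeFin.symm ((τ a).succ, τ) x.succ = x.succ ∧ 0 < c x.succ
        then 1 else 0) = if τ x = x ∧ 0 < c x.succ then 1 else 0 := by
    intro x hx
    have hne : τ x ≠ τ a := fun e => Finset.ne_of_mem_erase hx (τ.injective e)
    rw [Equiv.Perm.decomposeFin_symm_apply_succ, Equiv.swap_apply_of_ne_of_ne (Fin.succ_ne_zero _)
      (fun e => hne (Fin.succ_injective _ e))]
    simp only [Fin.succ_inj]
  rw [Finset.sum_congr rfl h, Equiv.Perm.decomposeFin_symm_apply_succ,
    Equiv.Perm.decomposeFin_symm_apply_zero, Equiv.swap_apply_right,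
    if_neg (fun e => Fin.succ_ne_zero _ e.1), if_neg (fun e => Fin.succ_ne_zero _ e.1.symm)]
  omega

end Insertion

/-! ### Recurrence for the enumerators by number of positive fixed points -/

/-- The contribution `x ^ asc * k ^ (n - cyc)` of a permutation of the letters `c`. -/
def weight (k : ℝ) {n : ℕ} (c : Fin n → ℤ) (σ : Equiv.Perm (Fin n)) : ℝ[X] :=
  X ^ asc c σ * C (k ^ reflLength σ)

/-- Of the n gaps of τ, those at its a ascents keep x^a and the others give x^{a+1}; a gap at a
positive fixed point also destroys that fixed point. The operator x d/dx supplies the factor a, and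
each insertion costs one factor k. -/
theorem sum_insert_weight {n : ℕ} (k : ℝ) (c : Fin (n + 1) → ℤ) (τ : Equiv.Perm (Fin n))
    (hc : (∀ j : Fin n, c 0 < c j.succ) ∨ ∀ j : Fin n, c j.succ < c 0) (f : ℕ) :
    ∑ i : Fin n, (if posFix c (Equiv.Perm.decomposeFin.symm (i.succ, τ)) = f
      then weight k c (Equiv.Perm.decomposeFin.symm (i.succ, τ)) else 0) =
    C k * (X * (1 - X) * derivative (if posFix (fun j => c j.succ) τ = f
        then weight k (fun j => c j.succ) τ else 0)
      + ((n : ℝ[X]) - (f : ℝ[X])) * X * (if posFix (fun j => c j.succ) τ = f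
        then weight k (fun j => c j.succ) τ else 0)
      + ((f : ℝ[X]) + 1) * X * (if posFix (fun j => c j.succ) τ = f + 1
        then weight k (fun j => c j.succ) τ else 0)) := by
  rw [← Equiv.sum_comp τ]
  set a := asc (fun j => c j.succ) τ with ha
  set m := posFix (fun j => c j.succ) τ with hm
  -- A fixed point is never an ascent, so the two indicators exclude each other and the contribution
  -- of a gap is affine in them. Summing then needs only the totals a and m.
  have hterm : ∀ i : Fin n, (if posFix c (Equiv.Perm.decomposeFin.symm ((τ i).succ, τ)) = f
      then weight k c (Equiv.Perm.decomposeFin.symm ((τ i).succ, τ)) else 0) =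
      C k * C (k ^ reflLength τ) * (
        (if c i.succ < c (τ i).succ then 1 else 0) * ((if m = f then 1 else 0) * (X ^ a * (1 - X)))
        + (if τ i = i ∧ 0 < c i.succ then 1 else 0) *
          (((if m = f + 1 then 1 else 0) - (if m = f then 1 else 0)) * X ^ (a + 1))
        + (if m = f then 1 else 0) * X ^ (a + 1)) := by
    intro i
    have h1 := asc_insert c τ hc i
    have h2 := posFix_insert c τ i
    rw [← ha] at h1
    rw [← hm] at h2
    rw [weight, reflLength_decomposeFin_symm_succ, pow_succ, C_mul]
    generalize asc c (Equiv.Perm.decomposeFin.symm ((τ i).succ, τ)) = a' at *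
    generalize posFix c (Equiv.Perm.decomposeFin.symm ((τ i).succ, τ)) = m' at *
    by_cases hfix : τ i = i ∧ 0 < c i.succ
    · have hasc : ¬ c i.succ < c (τ i).succ := by rw [hfix.1]; exact lt_irrefl _
      rw [if_pos hfix] at h2 ⊢
      rw [if_neg hasc] at h1 ⊢
      obtain rfl : a' = a + 1 := by omega
      rw [show m = m' + 1 by omega]
      simp only [Nat.add_right_cancel_iff]
      split_ifs <;> ring
    · rw [if_neg hfix] at h2 ⊢
      obtain rfl : m' = m := by omega
      by_cases hasc : c i.succ < c (τ i).succ
      · rw [if_pos hasc] at h1 ⊢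
        obtain rfl : a' = a := by omega
        split_ifs <;> ring
      · rw [if_neg hasc] at h1 ⊢
        obtain rfl : a' = a + 1 := by omega
        split_ifs <;> ring
  have hsa : ∑ i : Fin n, (if c i.succ < c (τ i).succ then (1 : ℝ[X]) else 0) = a := by
    rw [Finset.sum_boole, ha, asc]
  have hsm : ∑ i : Fin n, (if τ i = i ∧ 0 < c i.succ then (1 : ℝ[X]) else 0) = m := by
    rw [Finset.sum_boole, hm, posFix]
  rw [Finset.sum_congr rfl fun i _ => hterm i, ← Finset.mul_sum, Finset.sum_add_distrib,
    Finset.sum_add_distrib, ← Finset.sum_mul, ← Finset.sum_mul, hsa, hsm, Finset.sum_const,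
    Finset.card_univ, Fintype.card_fin, nsmul_eq_mul, weight, ← ha]
  have hder : X * derivative (X ^ a * C (k ^ reflLength τ)) =
      (a : ℝ[X]) * (X ^ a * C (k ^ reflLength τ)) := by
    cases a with
    | zero => simp
    | succ a =>
      rw [derivative_mul, derivative_C, derivative_X_pow]
      simp
      ring
  by_cases h1 : m = f
  · rw [if_pos h1, if_pos h1, if_neg (by omega), if_neg (by omega), ← h1]
    linear_combination (-C k * (1 - X)) * hder
  · rw [if_neg h1, if_neg h1]
    by_cases h2 : m = f + 1
    · rw [if_pos h2, if_pos h2, h2]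
      push_cast
      simp
      ring
    · rw [if_neg h2, if_neg h2]
      simp

/-- The values of the signed letters `±n, …, ±1`, in this order. -/
def letter {n : ℕ} (η : Fin n → ℤˣ) (j : Fin n) : ℤ := η j * ((n : ℤ) - j)

theorem letter_cons_zero {n : ℕ} (s : ℤˣ) (η : Fin n → ℤˣ) :
    letter (Fin.cons s η : Fin (n + 1) → ℤˣ) 0 = s * ((n : ℤ) + 1) := by
  simp [letter]

theorem letter_cons_succ {n : ℕ} (s : ℤˣ) (η : Fin n → ℤˣ) (j : Fin n) :
    letter (Fin.cons s η : Fin (n + 1) → ℤˣ) j.succ = letter η j := by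
  simp [letter]

theorem letter_cons_extreme {n : ℕ} (s : ℤˣ) (η : Fin n → ℤˣ) :
    (∀ j : Fin n, letter (Fin.cons s η : Fin (n + 1) → ℤˣ) 0 <
        letter (Fin.cons s η : Fin (n + 1) → ℤˣ) j.succ) ∨
      ∀ j : Fin n, letter (Fin.cons s η : Fin (n + 1) → ℤˣ) j.succ <
        letter (Fin.cons s η : Fin (n + 1) → ℤˣ) 0 := by
  simp only [letter_cons_zero, letter_cons_succ]
  simp only [letter]
  rcases Int.units_eq_one_or s with rfl | rfl
  · right
    intro j
    have := j.isLt
    rcases Int.units_eq_one_or (η j) with h | h <;> rw [h] <;> push_cast <;> omega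
  · left
    intro j
    have := j.isLt
    rcases Int.units_eq_one_or (η j) with h | h <;> rw [h] <;> push_cast <;> omega

/-- The contribution of a permutation of signed letters with exactly `f` positive fixed points. -/
def fixWeight (k : ℝ) {n : ℕ} (f : ℕ) (η : Fin n → ℤˣ) (σ : Equiv.Perm (Fin n)) : ℝ[X] :=
  if posFix (letter η) σ = f then weight k (letter η) σ else 0

/-- The polynomial of the signed permutations with exactly `f` positive fixed points. -/
def fixPoly (k : ℝ) (n f : ℕ) : ℝ[X] :=
  ∑ η : Fin n → ℤˣ, ∑ σ : Equiv.Perm (Fin n), fixWeight k f η σ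

/-- The polynomial of the signed permutations with exactly `f - 1` positive fixed points. -/
def predFixPoly (k : ℝ) (n : ℕ) : ℕ → ℝ[X]
  | 0 => 0
  | f + 1 => fixPoly k n f

/-- A new one-letter cycle gives the first two terms, for the negative and the positive sign.
Insertion into a gap gives the same result for both signs, hence the factor 2k. -/
theorem fixPoly_succ (k : ℝ) (n f : ℕ) :
    fixPoly k (n + 1) f = fixPoly k n f + predFixPoly k n f +
      C (2 * k) * (X * (1 - X) * derivative (fixPoly k n f)
        + ((n : ℝ[X]) - (f : ℝ[X])) * X * fixPoly k n f + ((f : ℝ[X]) + 1) * X * fixPoly k n (f + 1)) := by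
  have hins : ∀ (s : ℤˣ) (η : Fin n → ℤˣ) (τ : Equiv.Perm (Fin n)),
      ∑ i : Fin n, fixWeight k f (Fin.cons s η : Fin (n + 1) → ℤˣ)
        (Equiv.Perm.decomposeFin.symm (i.succ, τ)) =
      C k * (X * (1 - X) * derivative (fixWeight k f η τ)
        + ((n : ℝ[X]) - (f : ℝ[X])) * X * fixWeight k f η τ
        + ((f : ℝ[X]) + 1) * X * fixWeight k (f + 1) η τ) := by
    intro s η τ
    have h := sum_insert_weight k (letter (Fin.cons s η : Fin (n + 1) → ℤˣ)) τ
      (letter_cons_extreme s η) f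
    simp only [letter_cons_succ] at h
    exact h
  have hneg : ∀ (η : Fin n → ℤˣ) (τ : Equiv.Perm (Fin n)),
      fixWeight k f (Fin.cons (-1) η : Fin (n + 1) → ℤˣ)
        (Equiv.Perm.decomposeFin.symm (0, τ)) = fixWeight k f η τ := by
    intro η τ
    rw [fixWeight, weight, asc_insert_zero, posFix_insert_zero, reflLength_decomposeFin_symm_zero,
      letter_cons_zero,
      if_neg (show ¬ 0 < ((-1 : ℤˣ) : ℤ) * ((n : ℤ) + 1) by push_cast; omega), add_zero]
    simp only [letter_cons_succ]
    rfl
  have hpos : ∀ (η : Fin n → ℤˣ) (τ : Equiv.Perm (Fin n)),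
      fixWeight k f (Fin.cons 1 η : Fin (n + 1) → ℤˣ)
        (Equiv.Perm.decomposeFin.symm (0, τ)) =
      if posFix (letter η) τ + 1 = f then weight k (letter η) τ else 0 := by
    intro η τ
    rw [fixWeight, weight, asc_insert_zero, posFix_insert_zero, reflLength_decomposeFin_symm_zero,
      letter_cons_zero,
      if_pos (show 0 < ((1 : ℤˣ) : ℤ) * ((n : ℤ) + 1) by push_cast; omega)]
    simp only [letter_cons_succ]
    rfl
  have hpred : ∑ η : Fin n → ℤˣ, ∑ τ : Equiv.Perm (Fin n),
      (if posFix (letter η) τ + 1 = f then weight k (letter η) τ else 0) = predFixPoly k n f := by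
    cases f with
    | zero => simp [predFixPoly]
    | succ f => simp [predFixPoly, fixPoly, fixWeight]
  rw [← hpred]
  have hC : (C (2 * k) : ℝ[X]) = C k + C k := by rw [← C_add, two_mul]
  have hsplit : fixPoly k (n + 1) f = ∑ s : ℤˣ, ∑ η : Fin n → ℤˣ, ∑ τ : Equiv.Perm (Fin n),
      (fixWeight k f (Fin.cons s η : Fin (n + 1) → ℤˣ) (Equiv.Perm.decomposeFin.symm (0, τ)) +
      ∑ i : Fin n, fixWeight k f (Fin.cons s η : Fin (n + 1) → ℤˣ)
        (Equiv.Perm.decomposeFin.symm (i.succ, τ))) := by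
    rw [fixPoly, ← Equiv.sum_comp (Fin.consEquiv fun _ => ℤˣ), Fintype.sum_prod_type]
    refine Finset.sum_congr rfl fun s _ => Finset.sum_congr rfl fun η _ => ?_
    rw [← Equiv.sum_comp Equiv.Perm.decomposeFin.symm, Fintype.sum_prod_type_right]
    refine Finset.sum_congr rfl fun τ _ => ?_
    rw [Fin.sum_univ_succ]
    rfl
  have huniv : (Finset.univ : Finset ℤˣ) = {1, -1} := rfl
  rw [hsplit, huniv, Finset.sum_pair (by decide)]
  simp only [hins, hneg, hpos, Finset.sum_add_distrib, ← Finset.mul_sum, ← derivative_sum]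
  simp only [fixPoly]
  rw [hC]
  ring

theorem fixPoly_zero (k : ℝ) (f : ℕ) : fixPoly k 0 f = if f = 0 then 1 else 0 := by
  have hp : ∀ (c : Fin 0 → ℤ) σ, posFix c σ = 0 := fun c σ => by simp [posFix]
  have ha : ∀ (c : Fin 0 → ℤ) σ, asc c σ = 0 := fun c σ => by simp [asc]
  have hr : ∀ σ : Equiv.Perm (Fin 0), reflLength σ = 0 := fun σ => by
    rw [Subsingleton.elim σ 1]; simp [reflLength]
  simp [fixPoly, fixWeight, weight, hp, ha, hr, eq_comm]

/-- Combinatorially: mark one of the f + 1 positive fixed points and delete it, its absolute value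
being any of n. The proof is instead an induction on n through the recurrence for the F_{n,f}. -/
theorem succ_mul_fixPoly_succ (k : ℝ) (n : ℕ) :
    ∀ f : ℕ, ((f : ℝ[X]) + 1) * fixPoly k n (f + 1) = (n : ℝ[X]) * fixPoly k (n - 1) f := by
  induction n with
  | zero => intro f; simp [fixPoly_zero]
  | succ n ih =>
    intro f
    have h1 := ih f
    have h2 := ih (f + 1)
    have h3 : (n : ℝ[X]) * predFixPoly k (n - 1) f = (f : ℝ[X]) * fixPoly k n f := by
      cases f with
      | zero => simp [predFixPoly]
      | succ f => rw [predFixPoly, ← ih f]; push_cast; ring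
    have hd : ((f : ℝ[X]) + 1) * derivative (fixPoly k n (f + 1)) =
        (n : ℝ[X]) * derivative (fixPoly k (n - 1) f) := by
      have := congrArg derivative h1
      simpa using this
    -- The factor n makes this true also at n = 0, where n - 1 truncates and the recurrence is
    -- unavailable.
    have hn : (n : ℝ[X]) * fixPoly k n f = (n : ℝ[X]) * (fixPoly k (n - 1) f +
        predFixPoly k (n - 1) f + C (2 * k) * (X * (1 - X) * derivative (fixPoly k (n - 1) f)
        + ((n : ℝ[X]) - 1 - (f : ℝ[X])) * X * fixPoly k (n - 1) f
        + ((f : ℝ[X]) + 1) * X * fixPoly k (n - 1) (f + 1))) := by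
      cases n with
      | zero => simp
      | succ n =>
        rw [Nat.add_sub_cancel, fixPoly_succ]
        push_cast
        ring
    rw [fixPoly_succ, predFixPoly, Nat.add_sub_cancel]
    push_cast at h2 ⊢
    linear_combination (1 + C (2 * k) * X * ((n : ℝ[X]) - (f : ℝ[X]) - 1)) * h1
      + C (2 * k) * X * (1 - X) * hd + C (2 * k) * X * ((f : ℝ[X]) + 1) * h2 - hn - h3

theorem isDerangementSeq_fixPoly (k : ℝ) : IsDerangementSeq k fun n => fixPoly k n 0 where
  zero := by simp [fixPoly_zero]
  succ n := by
    have h := succ_mul_fixPoly_succ k n 0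
    rw [fixPoly_succ, predFixPoly]
    push_cast at h ⊢
    linear_combination C (2 * k) * X * h

/-! ### Signed permutations as permutations of signed letters -/

section Transport

variable {n : ℕ}

/-- The permutation of the letters `n, …, 1` (in this order) induced by a permutation. -/
def revConj : Equiv.Perm (Fin n) ≃ Equiv.Perm (Fin n) where
  toFun σ := Fin.revPerm * σ * Fin.revPerm⁻¹
  invFun σ := Fin.revPerm⁻¹ * σ * Fin.revPerm
  left_inv σ := by group
  right_inv σ := by group

theorem revConj_rev (σ : Equiv.Perm (Fin n)) (i : Fin n) :
    revConj σ (Fin.rev i) = Fin.rev (σ i) := by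
  simp [revConj]

/-- The signs of the letters of a signed permutation, largest absolute value first. -/
def letterSigns (σ : Equiv.Perm (Fin n)) : (Fin n → ℤˣ) ≃ (Fin n → ℤˣ) :=
  Equiv.arrowCongr (σ.trans Fin.revPerm) (Equiv.refl ℤˣ)

/-- The sign of w(i) belongs to the letter |w(i)|, not to the position i. Reversal puts the letter
of largest absolute value at index 0, where insertion takes place. -/
theorem letter_letterSigns (w : SignedPerm n) (i : Fin n) :
    letter (letterSigns w.1 w.2) (Fin.rev (w.1 i)) = w.val i := by
  have h := (w.1 i).isLt
  simp only [letter, letterSigns, SignedPerm.val, SignedPerm.absIdx, Equiv.arrowCongr_apply,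
    Function.comp_apply, Equiv.symm_trans_apply, Equiv.coe_refl, id_eq, Fin.revPerm_symm,
    Fin.revPerm_apply, Fin.rev_rev, Equiv.symm_apply_apply, Fin.val_rev]
  congr 1
  omega

theorem isFixed_iff (w : SignedPerm n) (i : Fin n) :
    w.IsFixed i ↔ revConj w.1 (Fin.rev i) = Fin.rev i ∧
      0 < letter (letterSigns w.1 w.2) (Fin.rev i) := by
  rw [revConj_rev, Fin.rev_inj, SignedPerm.IsFixed]
  constructor
  · intro h
    have h1 : w.1 i = i := by
      rw [SignedPerm.val, SignedPerm.absIdx] at h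
      rcases Int.units_eq_one_or (w.2 i) with hs | hs <;> rw [hs] at h <;> push_cast at h
      · exact Fin.ext (by omega)
      · omega
    refine ⟨h1, ?_⟩
    have hv := letter_letterSigns w i
    rw [h1] at hv
    rw [hv, h]
    omega
  · rintro ⟨h1, h2⟩
    have hv := letter_letterSigns w i
    rw [h1] at hv
    rw [hv] at h2
    rw [SignedPerm.val, SignedPerm.absIdx, h1] at h2 ⊢
    rcases Int.units_eq_one_or (w.2 i) with hs | hs <;> rw [hs] at h2 ⊢ <;> push_cast at h2 ⊢ <;>
      omega

theorem posFix_eq_zero_iff (w : SignedPerm n) :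
    posFix (letter (letterSigns w.1 w.2)) (revConj w.1) = 0 ↔ ∀ i, ¬ w.IsFixed i := by
  rw [posFix, Finset.card_eq_zero, Finset.filter_eq_empty_iff]
  simp only [isFixed_iff, Finset.mem_univ, true_imp_iff]
  exact ⟨fun h i => h (x := Fin.rev i), fun h i => by simpa using h (Fin.rev i)⟩

/-- Without fixed points, i is counted when w(i) < w(|w(i)|), which is an ascent at the letter
|w(i)|. The bijection is therefore i ↦ |w(i)|, reversed. -/
theorem wexc_eq_asc (w : SignedPerm n) (hw : ∀ i, ¬ w.IsFixed i) :
    w.wexc = asc (letter (letterSigns w.1 w.2)) (revConj w.1) := by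
  classical
  rw [SignedPerm.wexc, asc]
  refine Finset.card_equiv (w.1.trans Fin.revPerm) fun i => ?_
  simp only [Finset.mem_filter, Finset.mem_univ, true_and, SignedPerm.IsWeakExc, hw, false_or,
    Equiv.trans_apply, Fin.revPerm_apply]
  rw [revConj_rev, letter_letterSigns, letter_letterSigns]
  rfl

theorem sum_derangements (k : ℝ) (n : ℕ) :
    ∑ w ∈ derangements n, X ^ w.wexc * C (k ^ (n - w.cyc)) = fixPoly k n 0 := by
  classical
  have h : ∀ w : SignedPerm n, (if ∀ i, ¬ w.IsFixed i then
      (X ^ w.wexc * C (k ^ (n - w.cyc)) : ℝ[X]) else 0) =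
      fixWeight k 0 (letterSigns w.1 w.2) (revConj w.1) := by
    intro w
    rw [fixWeight]
    by_cases hw : ∀ i, ¬ w.IsFixed i
    · have hL : n - w.cyc = reflLength (revConj w.1) := by
        have h1 : Fintype.card (Fin n) - w.cyc = reflLength w.1 := card_sub_card_parts w.1
        rw [Fintype.card_fin] at h1
        rw [h1]
        exact (reflLength_conj w.1 Fin.revPerm).symm
      rw [if_pos hw, if_pos ((posFix_eq_zero_iff w).2 hw), weight, wexc_eq_asc w hw, hL]
    · rw [if_neg hw, if_neg fun e => hw ((posFix_eq_zero_iff w).1 e)]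
  rw [derangements, Finset.sum_filter]
  trans ∑ w : SignedPerm n, fixWeight k 0 (letterSigns w.1 w.2) (revConj w.1)
  · refine Finset.sum_congr rfl fun w _ => ?_
    rw [← h w]
  · rw [Fintype.sum_prod_type, fixPoly, Finset.sum_comm (s := (Finset.univ : Finset (Fin n → ℤˣ))), 
      ← Equiv.sum_comp revConj fun σ => ∑ η : Fin n → ℤˣ, fixWeight k 0 η σ]
    refine Finset.sum_congr rfl fun σ _ => ?_
    exact Equiv.sum_comp (letterSigns σ) fun η => fixWeight k 0 η (revConj σ)

end Transport

/-! ### The gamma expansion -/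

/-- The recurrences of the gamma coefficients. -/
structure IsGammaPair (k : ℝ) (p q : ℕ → ℤ → ℝ) : Prop where
  q_zero_zero : q 0 0 = 1
  q_zero : ∀ j : ℤ, j ≠ 0 → q 0 j = 0
  p_zero : ∀ j : ℤ, p 0 j = 0
  p_succ : ∀ (n : ℕ) (j : ℤ),
    p (n + 1) j = (1 + 2 * k * j) * p n j + 4 * k * (n - 2 * j + 1) * p n (j - 1)
      + 2 * k * n * p (n - 1) (j - 1) + q n j
  q_succ : ∀ (n : ℕ) (j : ℤ),
    q (n + 1) j = 2 * k * j * q n j + 4 * k * (n - 2 * j + 2) * q n (j - 1)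
      + 2 * k * n * q (n - 1) (j - 1) + (2 * k - 1) * p n (j - 1)

/-- Two consecutive rows `(p_n, q_n, p_{n-1}, q_{n-1})` of the gamma coefficients. -/
def gammaRows (k : ℝ) : ℕ → (ℤ → ℝ) × (ℤ → ℝ) × (ℤ → ℝ) × (ℤ → ℝ)
  | 0 => (0, Pi.single 0 1, 0, Pi.single 0 1)
  | n + 1 =>
    (fun j => (1 + 2 * k * j) * (gammaRows k n).1 j
        + 4 * k * (n - 2 * j + 1) * (gammaRows k n).1 (j - 1)
        + 2 * k * n * (gammaRows k n).2.2.1 (j - 1) + (gammaRows k n).2.1 j,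
      fun j => 2 * k * j * (gammaRows k n).2.1 j
        + 4 * k * (n - 2 * j + 2) * (gammaRows k n).2.1 (j - 1)
        + 2 * k * n * (gammaRows k n).2.2.2 (j - 1) + (2 * k - 1) * (gammaRows k n).1 (j - 1),
      (gammaRows k n).1, (gammaRows k n).2.1)

theorem exists_isGammaPair (k : ℝ) : ∃ p q, IsGammaPair k p q := by
  -- Row 0 serves as its own predecessor, in agreement with 0 - 1 = 0; its factor n is zero there.
  have h1 : ∀ n, (gammaRows k n).2.2.1 = (gammaRows k (n - 1)).1 := fun n => by cases n <;> rfl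
  have h2 : ∀ n, (gammaRows k n).2.2.2 = (gammaRows k (n - 1)).2.1 := fun n => by cases n <;> rfl
  refine ⟨fun n => (gammaRows k n).1, fun n => (gammaRows k n).2.1, ?_, ?_, ?_, ?_, ?_⟩
  · simp [gammaRows]
  · intro j hj
    simp [gammaRows, hj]
  · intro j
    simp [gammaRows]
  · intro n j
    simp only [gammaRows, h1]
  · intro n j
    simp only [gammaRows, h2]

namespace IsGammaPair

variable {k : ℝ} {p q : ℕ → ℤ → ℝ}

/-- Outside the ranges of P_n and Q_n the coefficients vanish. This lets sums be extended freely and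
makes truncated exponents harmless. -/
theorem eq_zero (h : IsGammaPair k p q) (n : ℕ) : (∀ j : ℤ, j < 0 ∨ (n : ℤ) ≤ 2 * j → p n j = 0) ∧
    ∀ j : ℤ, j < 0 ∨ (n : ℤ) < 2 * j → q n j = 0 := by
  induction n using Nat.strong_induction_on with
  | _ n ih =>
    cases n with
    | zero => exact ⟨fun j _ => h.p_zero j, fun j hj => h.q_zero j (by omega)⟩
    | succ n =>
      obtain ⟨ihp, ihq⟩ := ih n (by omega)
      have hprev : ∀ j : ℤ, (j < 0 ∨ (n : ℤ) + 1 ≤ 2 * j → (n : ℝ) * p (n - 1) (j - 1) = 0) ∧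
          (j < 0 ∨ (n : ℤ) + 1 < 2 * j → (n : ℝ) * q (n - 1) (j - 1) = 0) := by
        intro j
        cases n with
        | zero => simp
        | succ n =>
          obtain ⟨ihp', ihq'⟩ := ih n (by omega)
          rw [Nat.add_sub_cancel]
          push_cast
          exact ⟨fun hj => by rw [ihp' _ (by omega), mul_zero],
            fun hj => by rw [ihq' _ (by omega), mul_zero]⟩
      constructor
      · intro j hj
        push_cast at hj
        have e : ((n : ℝ) - 2 * j + 1) * p n (j - 1) = 0 := by
          -- On this boundary p(n, j-1) need not vanish, but its factor n - 2j + 1 does.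
          by_cases hn : (n : ℤ) + 1 = 2 * j
          · have : (n : ℝ) + 1 = 2 * j := by exact_mod_cast hn
            rw [show (n : ℝ) - 2 * j + 1 = 0 by linarith, zero_mul]
          · rw [ihp _ (by omega), mul_zero]
        rw [h.p_succ, ihp j (by omega), ihq j (by omega)]
        linear_combination 4 * k * e + 2 * k * (hprev j).1 (by omega)
      · intro j hj
        push_cast at hj
        have e : ((n : ℝ) - 2 * j + 2) * q n (j - 1) = 0 := by
          by_cases hn : (n : ℤ) + 2 = 2 * j
          · have : (n : ℝ) + 2 = 2 * j := by exact_mod_cast hn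
            rw [show (n : ℝ) - 2 * j + 2 = 0 by linarith, zero_mul]
          · rw [ihq _ (by omega), mul_zero]
        rw [h.q_succ, ihq j (by omega), ihp (j - 1) (by omega)]
        linear_combination 4 * k * e + 2 * k * (hprev j).2 (by omega)

theorem q_succ_zero (h : IsGammaPair k p q) (n : ℕ) : q (n + 1) 0 = 0 := by
  rw [h.q_succ, (h.eq_zero n).2 (0 - 1) (by omega), (h.eq_zero n).1 (0 - 1) (by omega),
    (h.eq_zero (n - 1)).2 (0 - 1) (by omega)]
  simp

/-- The condition k ≥ 1/2 is what makes 2k - 1 nonnegative. The factors n - 2j + 1 and n - 2j + 2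
are negative only where the coefficients they multiply vanish. -/
theorem nonneg (h : IsGammaPair k p q) (hk : 1 / 2 ≤ k) (n : ℕ) : ∀ j : ℤ, 0 ≤ p n j ∧ 0 ≤ q n j := by
  induction n using Nat.strong_induction_on with
  | _ n ih =>
    intro j
    cases n with
    | zero =>
      rw [h.p_zero]
      refine ⟨le_rfl, ?_⟩
      by_cases hj : j = 0
      · rw [hj, h.q_zero_zero]
        exact zero_le_one
      · rw [h.q_zero j hj]
    | succ n =>
      by_cases hj : j < 0
      · rw [(h.eq_zero (n + 1)).1 j (Or.inl hj), (h.eq_zero (n + 1)).2 j (Or.inl hj)]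
        exact ⟨le_rfl, le_rfl⟩
      have hj0 : (0 : ℝ) ≤ j := by exact_mod_cast not_lt.1 hj
      obtain ⟨hp, hq⟩ := ih n (by omega) j
      obtain ⟨hp1, hq1⟩ := ih n (by omega) (j - 1)
      obtain ⟨hp2, hq2⟩ := ih (n - 1) (by omega) (j - 1)
      have hk0 : 0 ≤ k := by linarith
      have hk1 : 0 ≤ 2 * k - 1 := by linarith
      have ep : 0 ≤ ((n : ℝ) - 2 * j + 1) * p n (j - 1) := by
        by_cases hn : (n : ℤ) - 2 * j + 1 < 0
        · rw [(h.eq_zero n).1 _ (by omega), mul_zero]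
        · have : (0 : ℝ) ≤ n - 2 * j + 1 := by exact_mod_cast not_lt.1 hn
          positivity
      have eq : 0 ≤ ((n : ℝ) - 2 * j + 2) * q n (j - 1) := by
        by_cases hn : (n : ℤ) - 2 * j + 2 < 0
        · rw [(h.eq_zero n).2 _ (by omega), mul_zero]
        · have : (0 : ℝ) ≤ n - 2 * j + 2 := by exact_mod_cast not_lt.1 hn
          positivity
      rw [h.p_succ, h.q_succ, mul_assoc (4 * k), mul_assoc (4 * k)]
      exact ⟨by positivity, by positivity⟩

end IsGammaPair

theorem gammaSum_eq_sum_range {m N : ℕ} {c : ℕ → ℝ} (hc : ∀ j, m < 2 * j → c j = 0)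
    (hN : m / 2 + 1 ≤ N) :
    gammaSum m c = ∑ j ∈ Finset.range N, C (c j) * (X ^ j * (1 + X) ^ (m - 2 * j)) := by
  rw [gammaSum, ← Finset.sum_subset (Finset.range_subset_range.2 hN)]
  · simp only [mul_assoc]
  · intro j _ hj
    rw [Finset.mem_range] at hj
    rw [hc j (by omega), C_0, zero_mul]

theorem X_mul_derivative_gammaTerm (j r : ℕ) :
    X * derivative (X ^ j * (1 + X) ^ r : ℝ[X]) =
      (j : ℝ[X]) * (X ^ j * (1 + X) ^ r) + (r : ℝ[X]) * (X ^ (j + 1) * (1 + X) ^ (r - 1)) := by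
  rw [derivative_mul, derivative_X_pow, derivative_pow]
  cases j with
  | zero => simp; ring
  | succ j => simp; ring

theorem sum_range_add_shift (N : ℕ) (a b : ℤ → ℝ) (t : ℕ → ℝ[X]) (ha : a N = 0) (hb : b (-1) = 0) :
    ∑ j ∈ Finset.range (N + 1), C (a j + b ((j : ℤ) - 1)) * t j =
      ∑ j ∈ Finset.range N, (C (a j) * t j + C (b j) * t (j + 1)) := by
  simp only [C_add, add_mul, Finset.sum_add_distrib]
  congr 1
  · rw [Finset.sum_range_succ, ha, C_0, zero_mul, add_zero]
  · rw [Finset.sum_range_succ']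
    simp [hb]

/-- The sum `P_n + Q_n` of the gamma expansions. -/
def gammaPoly (p q : ℕ → ℤ → ℝ) (n : ℕ) : ℝ[X] :=
  gammaSum (n - 1) (fun j => p n j) + gammaSum n (fun j => q n j)

theorem IsGammaPair.gammaPoly_eq {k : ℝ} {p q : ℕ → ℤ → ℝ} (h : IsGammaPair k p q) {n N : ℕ}
    (hN : n / 2 + 1 ≤ N) : gammaPoly p q n = ∑ j ∈ Finset.range N,
      (C (p n j) * (X ^ j * (1 + X) ^ (n - 1 - 2 * j)) +
        C (q n j) * (X ^ j * (1 + X) ^ (n - 2 * j))) := by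
  rw [gammaPoly, gammaSum_eq_sum_range (N := N) (fun j hj => (h.eq_zero n).1 j (by omega)) (by omega),
    gammaSum_eq_sum_range (N := N) (fun j hj => (h.eq_zero n).2 j (by omega)) (by omega),
    Finset.sum_add_distrib]

/-- After the shift in j is absorbed, both sides are sums over one common range of j, and they agree
term by term. The identities `i1` to `i4` expand the images of the p_n, q_n, p_{n-1} and q_{n-1}
terms. -/
theorem IsGammaPair.isDerangementSeq {k : ℝ} {p q : ℕ → ℤ → ℝ} (h : IsGammaPair k p q) :
    IsDerangementSeq k (gammaPoly p q) where
  zero := by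
    rw [h.gammaPoly_eq (N := 1) (by omega)]
    simp [h.p_zero, h.q_zero_zero]
  succ n := by
    have hp : p (n + 1) = fun j => ((1 + 2 * k * j) * p n j + q n j) +
        (fun i : ℤ => 4 * k * (n - 2 * i - 1) * p n i + 2 * k * (n * p (n - 1) i)) (j - 1) := by
      funext j
      rw [h.p_succ]
      push_cast
      ring
    have hq : q (n + 1) = fun j => 2 * k * j * q n j +
        (fun i : ℤ => 4 * k * (n - 2 * i) * q n i + 2 * k * (n * q (n - 1) i)
          + (2 * k - 1) * p n i) (j - 1) := by
      funext j
      rw [h.q_succ]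
      push_cast
      ring
    have z1 : ∀ m : ℕ, p m (-1) = 0 := fun m => (h.eq_zero m).1 _ (by omega)
    have z2 : ∀ m : ℕ, q m (-1) = 0 := fun m => (h.eq_zero m).2 _ (by omega)
    have z3 : p n ((n + 1 : ℕ) : ℤ) = 0 := (h.eq_zero n).1 _ (by push_cast; omega)
    have z4 : q n ((n + 1 : ℕ) : ℤ) = 0 := (h.eq_zero n).2 _ (by push_cast; omega)
    rw [h.gammaPoly_eq (n := n + 1) (N := n + 1 + 1) (by omega),
      h.gammaPoly_eq (n := n) (N := n + 1) (by omega),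
      h.gammaPoly_eq (n := n - 1) (N := n + 1) (by omega), hp, hq, Finset.sum_add_distrib,
      sum_range_add_shift (n + 1) (fun j => (1 + 2 * k * j) * p n j + q n j)
        (fun i : ℤ => 4 * k * (n - 2 * i - 1) * p n i + 2 * k * (n * p (n - 1) i))
        (fun j => X ^ j * (1 + X) ^ (n + 1 - 1 - 2 * j)) (by simp only [z3, z4]; simp)
        (by simp only [z1]; simp),
      sum_range_add_shift (n + 1) (fun j => 2 * k * j * q n j)
        (fun i : ℤ => 4 * k * (n - 2 * i) * q n i + 2 * k * (n * q (n - 1) i)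
          + (2 * k - 1) * p n i)
        (fun j => X ^ j * (1 + X) ^ (n + 1 - 2 * j)) (by simp only [z4]; simp)
        (by simp only [z1, z2]; simp),
      ← Finset.sum_add_distrib, derivative_sum, Finset.mul_sum, Finset.mul_sum, Finset.mul_sum,
      ← Finset.sum_add_distrib, ← Finset.sum_add_distrib]
    refine Finset.sum_congr rfl fun j _ => ?_
    have hC2 : (C (2 : ℝ) : ℝ[X]) = 2 := map_ofNat C 2
    have hC4 : (C (4 : ℝ) : ℝ[X]) = 4 := map_ofNat C 4
    -- Writing 1 = (1+x) - x raises the degree by one and moves a remainder into the Q part; this is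
    -- the source of the coefficient 2k - 1.
    have i1 : C (p n j) * ((1 + C (2 * k) * (n : ℝ[X]) * X) * (X ^ j * (1 + X) ^ (n - 1 - 2 * j)) +
        C (2 * k) * (1 - X) * (X * derivative (X ^ j * (1 + X) ^ (n - 1 - 2 * j)))) =
        C (p n j) * (C (1 + 2 * k * j) * (X ^ j * (1 + X) ^ (n - 2 * j)) +
          C (4 * k * (n - 2 * j - 1)) * (X ^ (j + 1) * (1 + X) ^ (n - 2 * (j + 1))) +
          C (2 * k - 1) * (X ^ (j + 1) * (1 + X) ^ (n + 1 - 2 * (j + 1)))) := by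
      by_cases hj : n ≤ 2 * j
      · rw [(h.eq_zero n).1 j (by omega), C_0, zero_mul, zero_mul]
      · obtain ⟨r, rfl⟩ : ∃ r, n = 2 * j + r + 1 := ⟨n - 2 * j - 1, by omega⟩
        congr 1
        rw [X_mul_derivative_gammaTerm, show 2 * j + r + 1 - 1 - 2 * j = r by omega,
          show 2 * j + r + 1 - 2 * j = r + 1 by omega,
          show 2 * j + r + 1 - 2 * (j + 1) = r - 1 by omega,
          show 2 * j + r + 1 + 1 - 2 * (j + 1) = r by omega]
        -- For r = 0 the exponent r - 1 truncates, but its term carries the factor r.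
        cases r with
        | zero => simp; ring
        | succ r => simp [hC2, hC4]; ring
    have i2 : C (q n j) * ((1 + C (2 * k) * (n : ℝ[X]) * X) * (X ^ j * (1 + X) ^ (n - 2 * j)) +
        C (2 * k) * (1 - X) * (X * derivative (X ^ j * (1 + X) ^ (n - 2 * j)))) =
        C (q n j) * (X ^ j * (1 + X) ^ (n - 2 * j) +
          C (2 * k * j) * (X ^ j * (1 + X) ^ (n + 1 - 2 * j)) +
          C (4 * k * (n - 2 * j)) * (X ^ (j + 1) * (1 + X) ^ (n + 1 - 2 * (j + 1)))) := by
      by_cases hj : n < 2 * j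
      · rw [(h.eq_zero n).2 j (by omega), C_0, zero_mul, zero_mul]
      · obtain ⟨r, rfl⟩ : ∃ r, n = 2 * j + r := ⟨n - 2 * j, by omega⟩
        congr 1
        rw [X_mul_derivative_gammaTerm, show 2 * j + r - 2 * j = r by omega,
          show 2 * j + r + 1 - 2 * j = r + 1 by omega,
          show 2 * j + r + 1 - 2 * (j + 1) = r - 1 by omega]
        cases r with
        | zero => simp; ring
        | succ r => simp [hC2, hC4]; ring
    have i3 : (n : ℝ[X]) * C (p (n - 1) j) * (X * (X ^ j * (1 + X) ^ (n - 1 - 1 - 2 * j))) =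
        (n : ℝ[X]) * C (p (n - 1) j) * (X ^ (j + 1) * (1 + X) ^ (n - 2 * (j + 1))) := by
      rw [show n - 1 - 1 - 2 * j = n - 2 * (j + 1) by omega]
      ring
    have i4 : (n : ℝ[X]) * C (q (n - 1) j) * (X * (X ^ j * (1 + X) ^ (n - 1 - 2 * j))) =
        (n : ℝ[X]) * C (q (n - 1) j) * (X ^ (j + 1) * (1 + X) ^ (n + 1 - 2 * (j + 1))) := by
      rw [show n - 1 - 2 * j = n + 1 - 2 * (j + 1) by omega]
      ring
    rw [derivative_add, derivative_C_mul, derivative_C_mul, Nat.add_sub_cancel]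
    simp only [C_add, C_mul, C_sub, map_natCast, Int.cast_natCast] at i1 i2 ⊢
    linear_combination - i1 - i2 - C 2 * C k * i3 - C 2 * C k * i4

/-! ### Degree and symmetry -/

theorem coeff_X_mul_derivative (f : ℝ[X]) (n : ℕ) :
    (X * derivative f).coeff n = n * f.coeff n := by
  cases n with
  | zero => simp
  | succ n =>
    rw [coeff_X_mul, coeff_derivative]
    push_cast
    ring

theorem IsDerangementSeq.coeff_succ {k : ℝ} {d : ℕ → ℝ[X]} (h : IsDerangementSeq k d) (n m : ℕ) :
    (d (n + 1)).coeff (m + 1) = (1 + 2 * k * (m + 1)) * (d n).coeff (m + 1)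
      + 2 * k * (n - m) * (d n).coeff m + 2 * k * n * (d (n - 1)).coeff m := by
  have e : d (n + 1) = d n + C (2 * k * n) * (X * d n)
      + C (2 * k) * (X * derivative (d n) - X * (X * derivative (d n)))
      + C (2 * k * n) * (X * d (n - 1)) := by
    have hC : (C (2 * k * n) : ℝ[X]) = C (2 * k) * (n : ℝ[X]) := by rw [C_mul, C_eq_natCast]
    rw [h.succ n, hC]
    ring
  rw [e]
  simp only [coeff_add, coeff_sub, coeff_C_mul, coeff_X_mul, coeff_X_mul_derivative,
    coeff_derivative]
  ring

theorem IsDerangementSeq.one {k : ℝ} {d : ℕ → ℝ[X]} (h : IsDerangementSeq k d) : d 1 = 1 := by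
  rw [h.succ 0, h.zero]
  simp

theorem IsDerangementSeq.coeff_eq_zero {k : ℝ} {d : ℕ → ℝ[X]} (h : IsDerangementSeq k d) (n : ℕ) :
    ∀ m, n ≤ m → 1 ≤ m → (d n).coeff m = 0 := by
  induction n using Nat.strong_induction_on with
  | _ n ih =>
    intro m hm hm1
    obtain ⟨m, rfl⟩ : ∃ i, m = i + 1 := ⟨m - 1, by omega⟩
    match n, ih with
    | 0, _ => rw [h.zero, coeff_one, if_neg (by omega)]
    | 1, _ => rw [h.one, coeff_one, if_neg (by omega)]
    | n + 2, ih =>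
      rw [h.coeff_succ, ih (n + 1) (by omega) _ (by omega) (by omega),
        ih (n + 1) (by omega) _ (by omega) (by omega), Nat.add_sub_cancel,
        ih n (by omega) _ (by omega) (by omega)]
      ring

/-- At the top degree the recurrence leaves 2k times the previous top coefficient plus a nonnegative
term from d_{n-1}. -/
theorem IsDerangementSeq.coeff_top_pos {k : ℝ} (hk : 0 < k) {d : ℕ → ℝ[X]}
    (h : IsDerangementSeq k d) (n : ℕ) : 0 < (d (n + 1)).coeff n := by
  induction n with
  | zero => rw [h.one]; simp
  | succ n ih =>
    rw [h.coeff_succ (n + 1) n, h.coeff_eq_zero (n + 1) (n + 1) le_rfl (by omega),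
      Nat.add_sub_cancel]
    have h1 : 0 ≤ (d n).coeff n := by
      cases n with
      | zero => rw [h.zero]; simp
      | succ n => rw [h.coeff_eq_zero (n + 1) (n + 1) le_rfl (by omega)]
    push_cast
    have h2 : 0 < 2 * k * ((n : ℝ) + 1 - n) * (d (n + 1)).coeff n := by
      rw [add_sub_cancel_left]
      positivity
    have h3 : 0 ≤ 2 * k * ((n : ℝ) + 1) * (d n).coeff n := by positivity
    linarith

theorem IsDerangementSeq.natDegree {k : ℝ} (hk : 0 < k) {d : ℕ → ℝ[X]}
    (h : IsDerangementSeq k d) (n : ℕ) : (d (n + 1)).natDegree = n := by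
  refine le_antisymm ?_ (le_natDegree_of_ne_zero (h.coeff_top_pos hk n).ne')
  rw [natDegree_le_iff_coeff_eq_zero]
  intro m hm
  exact h.coeff_eq_zero (n + 1) m (by omega) (by omega)

theorem isSymmetric_gammaSum (m : ℕ) (c : ℕ → ℝ) : IsSymmetric m (gammaSum m c) := by
  intro x hx
  rw [gammaSum, eval_finsetSum, eval_finsetSum, Finset.mul_sum]
  refine Finset.sum_congr rfl fun j hj => ?_
  rw [Finset.mem_range] at hj
  obtain ⟨r, rfl⟩ : ∃ r, m = 2 * j + r := ⟨m - 2 * j, by omega⟩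
  simp only [eval_mul, eval_C, eval_pow, eval_X, eval_add, eval_one, Nat.add_sub_cancel_left,
    zpow_natCast]
  have h1 : x * (1 + x⁻¹) = 1 + x := by
    rw [mul_add, mul_one, mul_inv_cancel₀ hx, add_comm]
  have h2 : x * x⁻¹ = 1 := mul_inv_cancel₀ hx
  have h3 : x ^ (2 * j + r) * (c j * x⁻¹ ^ j * (1 + x⁻¹) ^ r) =
      c j * x ^ j * (x * x⁻¹) ^ j * (x * (1 + x⁻¹)) ^ r := by
    rw [mul_pow, mul_pow]
    ring
  rw [h3, h1, h2, one_pow, mul_one]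

theorem IsSymmetric.of_X_mul {m : ℤ} {f : ℝ[X]} (h : IsSymmetric m (X * f)) :
    IsSymmetric (m - 2) f := by
  intro x hx
  have h1 := h x hx
  rw [eval_mul, eval_mul, eval_X, eval_X] at h1
  refine mul_left_cancel₀ hx ?_
  rw [h1, zpow_sub₀ hx]
  field_simp

theorem X_mul_divX_gammaSum (m : ℕ) {c : ℕ → ℝ} (hc : c 0 = 0) :
    X * (gammaSum m c).divX = gammaSum m c := by
  have h0 : (gammaSum m c).coeff 0 = 0 := by
    rw [gammaSum, coeff_zero_eq_eval_zero, eval_finsetSum]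
    refine Finset.sum_eq_zero fun j _ => ?_
    cases j with
    | zero => simp [hc]
    | succ j => simp
  have h1 := X_mul_divX_add (gammaSum m c)
  rwa [h0, C_0, add_zero] at h1

theorem divX_gammaSum (m : ℕ) {c : ℕ → ℝ} (hc : c 0 = 0) :
    (gammaSum (m + 2) c).divX = gammaSum m fun j => c (j + 1) := by
  refine mul_left_cancel₀ (X_ne_zero (R := ℝ)) ?_
  rw [X_mul_divX_gammaSum _ hc, gammaSum, gammaSum, show (m + 2) / 2 + 1 = m / 2 + 1 + 1 by omega,
    Finset.sum_range_succ', hc, Finset.mul_sum]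
  simp only [C_0, zero_mul, add_zero]
  refine Finset.sum_congr rfl fun j _ => ?_
  rw [show m + 2 - 2 * (j + 1) = m - 2 * j by omega]
  ring

/-- P_{n+1} is symmetric with respect to n, the degree of d_{n+1}. Q_{n+1} is symmetric with respect
to n + 1 and divisible by x since q(n+1,0) = 0, so its quotient is symmetric with respect to n - 1.
-/
theorem IsGammaPair.isSymmetricDecomposition {k : ℝ} (hk : 0 < k) {p q : ℕ → ℤ → ℝ}
    (h : IsGammaPair k p q) (n : ℕ) :
    IsSymmetricDecomposition (gammaPoly p q (n + 1)) (gammaSum n fun j => p (n + 1) j)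
      (gammaSum (n + 1) fun j => q (n + 1) j).divX := by
  have hq : (fun j : ℕ => q (n + 1) j) 0 = 0 := h.q_succ_zero n
  rw [IsSymmetricDecomposition, h.isDerangementSeq.natDegree hk, X_mul_divX_gammaSum _ hq]
  refine ⟨rfl, isSymmetric_gammaSum _ _, ?_⟩
  have hs := isSymmetric_gammaSum (n + 1) fun j => q (n + 1) j
  rw [← X_mul_divX_gammaSum _ hq] at hs
  convert hs.of_X_mul using 1
  push_cast
  ring

theorem IsGammaPair.isBiGammaPositive {k : ℝ} (hk : 1 / 2 ≤ k) {p q : ℕ → ℤ → ℝ}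
    (h : IsGammaPair k p q) (n : ℕ) : IsBiGammaPositive (gammaPoly p q (n + 1)) := by
  have hk0 : 0 < k := by linarith
  have hq : (fun j : ℕ => q (n + 1) j) 0 = 0 := h.q_succ_zero n
  refine ⟨_, _, h.isSymmetricDecomposition hk0 n, ?_, ?_⟩ <;>
    rw [h.isDerangementSeq.natDegree hk0]
  · exact ⟨_, fun j => (h.nonneg hk (n + 1) j).1, rfl⟩
  · refine ⟨fun j => q (n + 1) (j + 1 : ℕ), fun j => (h.nonneg hk (n + 1) _).2, ?_⟩
    -- For d_1 = 1 the number n - 1 truncates to 0; the required expansion is then that of b = 0.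
    cases n with
    | zero =>
      have h1 : q 1 1 = 0 := (h.eq_zero 1).2 1 (by norm_num)
      have h2 := h.q_succ_zero 0
      rw [zero_add] at h2
      simp [gammaSum, h1, h2]
    | succ n => exact divX_gammaSum n hq

end TypeB
end

theorem theorem2 (k : ℝ) (hk : 0 < k) :
    -- the polynomials `d_n^B(x;k)` have the defining exponential generating function
    (PowerSeries.mk (fun n : ℕ =>
        algebraMap ℝ[X] (RatFunc ℝ) (TypeB.derangementPoly k n) / (n.factorial : RatFunc ℝ)) =
      TypeB.derangementEGF k) ∧
    -- combinatorial interpretation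
    (∀ n : ℕ, 1 ≤ n →
      TypeB.derangementPoly k n =
        ∑ w ∈ TypeB.derangements n, X ^ w.wexc * C (k ^ (n - w.cyc))) ∧
    -- bi-gamma-positivity
    (1 / 2 ≤ k → ∀ n : ℕ, 1 ≤ n → TypeB.IsBiGammaPositive (TypeB.derangementPoly k n)) ∧
    -- the explicit symmetric decomposition
    ∃ p q : ℕ → ℤ → ℝ,
      q 0 0 = 1 ∧ (∀ j : ℤ, j ≠ 0 → q 0 j = 0) ∧ (∀ j : ℤ, p 0 j = 0) ∧
      (∀ (n : ℕ) (j : ℤ),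
        p (n + 1) j = (1 + 2 * k * j) * p n j + 4 * k * (n - 2 * j + 1) * p n (j - 1)
          + 2 * k * n * p (n - 1) (j - 1) + q n j) ∧
      (∀ (n : ℕ) (j : ℤ),
        q (n + 1) j = 2 * k * j * q n j + 4 * k * (n - 2 * j + 2) * q n (j - 1)
          + 2 * k * n * q (n - 1) (j - 1) + (2 * k - 1) * p n (j - 1)) ∧
      (∀ n : ℕ, 1 ≤ n →
        TypeB.derangementPoly k n =
          TypeB.gammaSum (n - 1) (fun j => p n j) + TypeB.gammaSum n (fun j => q n j) ∧
        TypeB.IsSymmetricDecomposition (TypeB.derangementPoly k n)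
          (TypeB.gammaSum (n - 1) (fun j => p n j))
          (TypeB.gammaSum n (fun j => q n j)).divX) ∧
      (1 / 2 ≤ k → ∀ (n : ℕ) (j : ℤ), 0 ≤ p n j ∧ 0 ≤ q n j) := by
  obtain ⟨p, q, h⟩ := TypeB.exists_isGammaPair k
  have hd : ∀ n, TypeB.derangementPoly k n = TypeB.gammaPoly p q n :=
    h.isDerangementSeq.derangementPoly_eq hk.ne'
  refine ⟨h.isDerangementSeq.mk_derangementPoly hk.ne', fun n _ => ?_, fun hk2 n hn => ?_,
    p, q, h.q_zero_zero, h.q_zero, h.p_zero, h.p_succ, h.q_succ, fun n hn => ?_,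
    fun hk2 n j => h.nonneg hk2 n j⟩
  · rw [(TypeB.isDerangementSeq_fixPoly k).derangementPoly_eq hk.ne', TypeB.sum_derangements]
  · obtain ⟨n, rfl⟩ : ∃ m, n = m + 1 := ⟨n - 1, by omega⟩
    rw [hd]
    exact h.isBiGammaPositive hk2 n
  · obtain ⟨n, rfl⟩ : ∃ m, n = m + 1 := ⟨n - 1, by omega⟩
    rw [hd]
    exact ⟨rfl, h.isSymmetricDecomposition hk n⟩
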